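/- Let $(M_p)_{p\ge 0}$ be a sequence of positive numbers with $M_0=1$ satisfying (M.1) $M_p^2\le M_{p-1}M_{p+1}$ for all $p\ge 1$; (M.2) there are $A,H>0$ such that $M_p\le A H^p\min_{0\le q\le p}M_qM_{p-q}$ for all $p\ge 0$. For $m>0$ let $\mathcal S^{M_p,m}$ be the space of all smooth $\varphi:\mathbb R\to\mathbb C$ such that $$\|\varphi\|_m=\sup_{\alpha,\beta\in\mathbb N_0}\frac{m^{\alpha+\beta}}{M_\alpha M_\beta}\,\sup_{x\in\mathbb R}(1+x^2)^{\beta/2}|\varphi^{(\alpha)}(x)|<\infty .$$ Let $\mathcal S^{\{M_p\}}=\bigcup_{m>0}\mathcal S^{M_p,m}$ carry the locally convex inductive limit topology, and let $\mathcal S^{(M_p)}=\bigcap_{m>0}\mathcal S^{M_p,m}$ carry the projective limit topology. Let $\mathcal S^{\{M_p\}\prime}$ and $\mathcal S^{(M_p)\prime}$ be their strong duals. A bounded continuous function $f:\mathbb R\to\mathbb C$ is identified with the functional $\varphi\mapsto\int_{\mathbb R}f\varphi\,dx$, and the operator $N=-\frac{d^2}{dx^2}+x^2-1$ acts on the dual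 spaces by $\langle NT,\varphi\rangle=\langle T,N\varphi\rangle$. **Roumieu case.** Assume that (M.3)'' there are $C,L>0$ with $p^{p/2}\le C L^pM_p$ for all $p\ge 0$ (where $0^0=1$). Then for every $T\in\mathcal S^{\{M_p\}\prime}$ and every $\mu>0$ there is a bounded continuous function $f:\mathbb R\to\mathbb C$ such that $$T=\sum_{\beta=0}^\infty\frac{\mu^{2\beta}}{M_{2\beta}}\,\frac1{2^\beta}\Big(-\frac{d^2}{dx^2}+x^2-1\Big)^{\beta}f ,$$ the series converging (unconditionally) in $\mathcal S^{\{M_p\}\prime}$. **Beurling case.** Assume that (M.3)''' for every $L>0$ there is $C>0$ with $p^{p/2}\le C L^pM_p$ for all $p\ge 1$. Then for every $T\in\mathcal S^{(M_p)\prime}$ there are $\mu>0$ and a bounded continuous function $f:\mathbb R\to\mathbb C$ such that the same expansion holds, the series converging (unconditionally) in $\mathcal S^{(M_p)\prime}$. -/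

import Mathlib

open MeasureTheory Set
open scoped ContDiff BoundedContinuousFunction

noncomputable section

namespace GelfandShilov

/-! ## Weight sequences -/

/-- A sequence of positive numbers with `M 0 = 1` which is logarithmically convex, (M.1), and
stable under ultradifferential operators, (M.2). -/
structure WeightSequence where
  /-- the underlying sequence -/
  seq : ℕ → ℝ
  pos : ∀ p, 0 < seq p
  zero_eq_one : seq 0 = 1
  /-- (M.1) -/
  logConvex : ∀ p, 1 ≤ p → seq p ^ 2 ≤ seq (p - 1) * seq (p + 1)
  /-- (M.2) -/
  stable : ∃ A H : ℝ, 0 < A ∧ 0 < H ∧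
    ∀ p q, q ≤ p → seq p ≤ A * H ^ p * (seq q * seq (p - q))

instance : CoeFun WeightSequence (fun _ => ℕ → ℝ) := ⟨WeightSequence.seq⟩

/-- The condition (M.3)'': there are `C, L > 0` with `p ^ (p / 2) ≤ C L ^ p M p` for all `p`. -/
def WeightSequence.NontrivialRoumieu (M : WeightSequence) : Prop :=
  ∃ C L : ℝ, 0 < C ∧ 0 < L ∧ ∀ p : ℕ, (p : ℝ) ^ ((p : ℝ) / 2) ≤ C * L ^ p * M p

/-- The condition (M.3)''': for every `L > 0` there is `C > 0` with
`p ^ (p / 2) ≤ C L ^ p M p` for all `p ≥ 1`. -/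
def WeightSequence.NontrivialBeurling (M : WeightSequence) : Prop :=
  ∀ L : ℝ, 0 < L → ∃ C : ℝ, 0 < C ∧
    ∀ p : ℕ, 1 ≤ p → (p : ℝ) ^ ((p : ℝ) / 2) ≤ C * L ^ p * M p

/-! ## The Banach spaces of which the Gelfand–Shilov spaces are limits -/

/-- The quantity `m ^ (α + β) / (M α * M β) * (1 + x ^ 2) ^ (β / 2) * |φ^(α) (x)|`, at the triple
`(α, β, x)`. -/
def stepTerm (M : WeightSequence) (m : ℝ) (φ : ℝ → ℂ) (t : ℕ × ℕ × ℝ) : ℝ :=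
  m ^ (t.1 + t.2.1) / (M t.1 * M t.2.1) *
    ((1 + t.2.2 ^ 2) ^ ((t.2.1 : ℝ) / 2) * ‖iteratedDeriv t.1 φ t.2.2‖)

lemma stepTerm_nonneg (M : WeightSequence) {m : ℝ} (hm : 0 < m) (φ : ℝ → ℂ) (t : ℕ × ℕ × ℝ) :
    0 ≤ stepTerm M m φ t := by
  have h1 := M.pos t.1
  have h2 := M.pos t.2.1
  unfold stepTerm
  positivity

lemma stepTerm_mono (M : WeightSequence) {m m' : ℝ} (hm : 0 < m) (h : m ≤ m') (φ : ℝ → ℂ)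
    (t : ℕ × ℕ × ℝ) : stepTerm M m φ t ≤ stepTerm M m' φ t := by
  have h1 := M.pos t.1
  have h2 := M.pos t.2.1
  unfold stepTerm
  gcongr

lemma stepTerm_zero (M : WeightSequence) (m : ℝ) (t : ℕ × ℕ × ℝ) :
    stepTerm M m 0 t = 0 := by
  have : iteratedDeriv t.1 (0 : ℝ → ℂ) t.2.2 = 0 := by simp
  simp [stepTerm, this]

lemma stepTerm_smul (M : WeightSequence) (m : ℝ) (c : ℂ) (φ : ℝ → ℂ) (t : ℕ × ℕ × ℝ) :
    stepTerm M m (c • φ) t = ‖c‖ * stepTerm M m φ t := by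
  simp only [stepTerm, iteratedDeriv_const_smul_field, norm_smul]
  ring

lemma stepTerm_add (M : WeightSequence) {m : ℝ} (hm : 0 < m) {φ ψ : ℝ → ℂ}
    (hφ : ContDiff ℝ ∞ φ) (hψ : ContDiff ℝ ∞ ψ) (t : ℕ × ℕ × ℝ) :
    stepTerm M m (φ + ψ) t ≤ stepTerm M m φ t + stepTerm M m ψ t := by
  have h1 := M.pos t.1
  have h2 := M.pos t.2.1
  have h : iteratedDeriv t.1 (φ + ψ) t.2.2
      = iteratedDeriv t.1 φ t.2.2 + iteratedDeriv t.1 ψ t.2.2 :=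
    iteratedDeriv_add (hφ.of_le (by exact_mod_cast le_top)).contDiffAt
      (hψ.of_le (by exact_mod_cast le_top)).contDiffAt
  simp only [stepTerm, h]
  rw [← mul_add, ← mul_add]
  gcongr
  exact norm_add_le _ _

/-- The space of the smooth functions `φ` on `ℝ` with
`sup_{α, β, x} m ^ (α + β) / (M α * M β) * (1 + x ^ 2) ^ (β / 2) * |φ^(α) (x)| < ∞`. -/
def step (M : WeightSequence) (m : Ioi (0 : ℝ)) : Submodule ℂ (ℝ → ℂ) where
  carrier := {φ | ContDiff ℝ ∞ φ ∧ BddAbove (range (stepTerm M m φ))}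
  zero_mem' := ⟨contDiff_const, 0, by rintro _ ⟨t, rfl⟩; exact (stepTerm_zero M m t).le⟩
  add_mem' := by
    rintro φ ψ ⟨hφ, A, hA⟩ ⟨hψ, B, hB⟩
    refine ⟨hφ.add hψ, A + B, ?_⟩
    rintro _ ⟨t, rfl⟩
    exact (stepTerm_add M m.2 hφ hψ t).trans (add_le_add (hA ⟨t, rfl⟩) (hB ⟨t, rfl⟩))
  smul_mem' := by
    rintro c φ ⟨hφ, A, hA⟩
    refine ⟨contDiff_const.smul hφ, ‖c‖ * A, ?_⟩
    rintro _ ⟨t, rfl⟩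
    rw [stepTerm_smul]
    exact mul_le_mul_of_nonneg_left (hA ⟨t, rfl⟩) (norm_nonneg c)

/-- The norm
`sup_{α, β, x} m ^ (α + β) / (M α * M β) * (1 + x ^ 2) ^ (β / 2) * |φ^(α) (x)|` of `step M m`. -/
def stepNorm (M : WeightSequence) (m : Ioi (0 : ℝ)) : Seminorm ℂ (step M m) :=
  Seminorm.ofSMulLE (fun φ => ⨆ t, stepTerm M m φ.1 t)
    (by simp [stepTerm_zero])
    (fun φ ψ => ciSup_le fun t => (stepTerm_add M m.2 φ.2.1 ψ.2.1 t).trans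
      (add_le_add (le_ciSup φ.2.2 t) (le_ciSup ψ.2.2 t)))
    (fun c φ => ciSup_le fun t => by
      have h : stepTerm M m (c • φ : step M m).1 t = ‖c‖ * stepTerm M m φ.1 t :=
        stepTerm_smul M m c φ.1 t
      rw [h]
      exact mul_le_mul_of_nonneg_left (le_ciSup φ.2.2 t) (norm_nonneg c))

lemma stepTerm_le_stepNorm (M : WeightSequence) (m : Ioi (0 : ℝ)) (φ : step M m)
    (t : ℕ × ℕ × ℝ) : stepTerm M m φ.1 t ≤ stepNorm M m φ :=
  le_ciSup φ.2.2 t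

lemma stepNorm_le (M : WeightSequence) (m : Ioi (0 : ℝ)) (φ : step M m) {C : ℝ}
    (h : ∀ t, stepTerm M m φ.1 t ≤ C) : stepNorm M m φ ≤ C :=
  ciSup_le h

lemma step_anti (M : WeightSequence) {m m' : Ioi (0 : ℝ)} (h : (m : ℝ) ≤ m') :
    step M m' ≤ step M m := by
  rintro φ ⟨hφ, A, hA⟩
  refine ⟨hφ, A, ?_⟩
  rintro _ ⟨t, rfl⟩
  exact (stepTerm_mono M m.2 h φ t).trans (hA ⟨t, rfl⟩)

/-! ## The Gelfand–Shilov spaces of Roumieu and of Beurling type -/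

/-- The union of the spaces `step M m`, `m > 0`. -/
def roumieu (M : WeightSequence) : Submodule ℂ (ℝ → ℂ) where
  carrier := {φ | ∃ m, φ ∈ step M m}
  zero_mem' := ⟨⟨1, mem_Ioi.2 one_pos⟩, zero_mem _⟩
  add_mem' := by
    rintro φ ψ ⟨m, hm⟩ ⟨m', hm'⟩
    refine ⟨⟨min (m : ℝ) m', mem_Ioi.2 (lt_min m.2 m'.2)⟩, add_mem ?_ ?_⟩
    · exact step_anti M (min_le_left _ _) hm
    · exact step_anti M (min_le_right _ _) hm'
  smul_mem' := by
    rintro c φ ⟨m, hm⟩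
    exact ⟨m, Submodule.smul_mem _ c hm⟩

/-- The intersection of the spaces `step M m`, `m > 0`. -/
def beurling (M : WeightSequence) : Submodule ℂ (ℝ → ℂ) := ⨅ m, step M m

lemma beurling_le_step (M : WeightSequence) (m : Ioi (0 : ℝ)) : beurling M ≤ step M m :=
  iInf_le _ m

/-- The Gelfand–Shilov space `S^{M_p}(ℝ)` of Roumieu type. It gets its own topology below, which
is not the one of pointwise convergence. -/
def RoumieuSpace (M : WeightSequence) : Type := roumieu M

/-- The Gelfand–Shilov space `S^(M_p)(ℝ)` of Beurling type. It gets its own topology below, which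
is not the one of pointwise convergence. -/
def BeurlingSpace (M : WeightSequence) : Type := beurling M

instance (M : WeightSequence) : AddCommGroup (RoumieuSpace M) :=
  inferInstanceAs (AddCommGroup (roumieu M))

instance (M : WeightSequence) : Module ℂ (RoumieuSpace M) :=
  inferInstanceAs (Module ℂ (roumieu M))

instance (M : WeightSequence) : AddCommGroup (BeurlingSpace M) :=
  inferInstanceAs (AddCommGroup (beurling M))

instance (M : WeightSequence) : Module ℂ (BeurlingSpace M) :=
  inferInstanceAs (Module ℂ (beurling M))

/-- The function `ℝ → ℂ` underlying an element of the Roumieu space. -/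
def RoumieuSpace.toFun {M : WeightSequence} : RoumieuSpace M → ℝ → ℂ :=
  (roumieu M).subtype

lemma RoumieuSpace.exists_mem_step {M : WeightSequence} (φ : RoumieuSpace M) :
    ∃ m, φ.toFun ∈ step M m := φ.2

@[simp] lemma RoumieuSpace.toFun_add {M : WeightSequence} (φ ψ : RoumieuSpace M) :
    (φ + ψ).toFun = φ.toFun + ψ.toFun := rfl

@[simp] lemma RoumieuSpace.toFun_smul {M : WeightSequence} (c : ℂ) (φ : RoumieuSpace M) :
    (c • φ).toFun = c • φ.toFun := rfl

lemma RoumieuSpace.ext {M : WeightSequence} {φ ψ : RoumieuSpace M}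
    (h : φ.toFun = ψ.toFun) : φ = ψ := Subtype.ext h

/-- The function `ℝ → ℂ` underlying an element of the Beurling space. -/
def BeurlingSpace.toFun {M : WeightSequence} : BeurlingSpace M → ℝ → ℂ :=
  (beurling M).subtype

lemma BeurlingSpace.mem_step {M : WeightSequence} (φ : BeurlingSpace M) (m : Ioi (0 : ℝ)) :
    φ.toFun ∈ step M m := beurling_le_step M m φ.2

@[simp] lemma BeurlingSpace.toFun_add {M : WeightSequence} (φ ψ : BeurlingSpace M) :
    (φ + ψ).toFun = φ.toFun + ψ.toFun := rfl

@[simp] lemma BeurlingSpace.toFun_smul {M : WeightSequence} (c : ℂ) (φ : BeurlingSpace M) :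
    (c • φ).toFun = c • φ.toFun := rfl

lemma BeurlingSpace.ext {M : WeightSequence} {φ ψ : BeurlingSpace M}
    (h : φ.toFun = ψ.toFun) : φ = ψ := Subtype.ext h

/-- A seminorm on the Roumieu space whose restriction to each of the spaces `step M m`, `m > 0`,
is continuous. -/
def IsInductive (M : WeightSequence) (p : Seminorm ℂ (RoumieuSpace M)) : Prop :=
  ∀ m, ∃ C : ℝ, ∀ (φ : RoumieuSpace M) (h : φ.toFun ∈ step M m),
    p φ ≤ C * stepNorm M m ⟨φ.toFun, h⟩

/-- All seminorms on the Roumieu space whose restrictions to the spaces `step M m` are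
continuous. -/
def roumieuSeminorms (M : WeightSequence) :
    SeminormFamily ℂ (RoumieuSpace M) {p : Seminorm ℂ (RoumieuSpace M) // IsInductive M p} :=
  fun p => p.1

instance (M : WeightSequence) :
    Nonempty {p : Seminorm ℂ (RoumieuSpace M) // IsInductive M p} :=
  ⟨⟨0, fun _ => ⟨0, fun φ _ => by simp⟩⟩⟩

/-- The topology of the locally convex inductive limit of the spaces `step M m`, `m > 0`: the
finest locally convex topology for which all the inclusions of `step M m` are continuous, that is,
the topology given by all the seminorms whose restrictions to the `step M m` are continuous. -/
instance (M : WeightSequence) : TopologicalSpace (RoumieuSpace M) :=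
  (roumieuSeminorms M).moduleFilterBasis.topology

lemma roumieu_withSeminorms (M : WeightSequence) : WithSeminorms (roumieuSeminorms M) := ⟨rfl⟩

/-- The norms of the spaces `step M m`, `m > 0`, on the Beurling space. -/
def beurlingSeminorms (M : WeightSequence) : SeminormFamily ℂ (BeurlingSpace M) (Ioi (0 : ℝ)) :=
  fun m => (stepNorm M m).comp (Submodule.inclusion (beurling_le_step M m))

instance : Nonempty (Ioi (0 : ℝ)) := ⟨⟨1, mem_Ioi.2 one_pos⟩⟩

/-- The topology of the projective limit of the spaces `step M m`, `m > 0`. -/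
instance (M : WeightSequence) : TopologicalSpace (BeurlingSpace M) :=
  (beurlingSeminorms M).moduleFilterBasis.topology

lemma beurling_withSeminorms (M : WeightSequence) : WithSeminorms (beurlingSeminorms M) := ⟨rfl⟩

instance (M : WeightSequence) : IsTopologicalAddGroup (RoumieuSpace M) :=
  (roumieu_withSeminorms M).topologicalAddGroup

instance (M : WeightSequence) : ContinuousSMul ℂ (RoumieuSpace M) :=
  (roumieu_withSeminorms M).continuousSMul

instance (M : WeightSequence) : IsTopologicalAddGroup (BeurlingSpace M) :=
  (beurling_withSeminorms M).topologicalAddGroup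

instance (M : WeightSequence) : ContinuousSMul ℂ (BeurlingSpace M) :=
  (beurling_withSeminorms M).continuousSMul

/-! ## The operator `- d² / dx² + x² - 1` on test functions -/

/-- The operator `- d² / dx² + x² - 1` on functions. -/
def oscFun (φ : ℝ → ℂ) : ℝ → ℂ := fun x => - iteratedDeriv 2 φ x + (x : ℂ) ^ 2 * φ x - φ x

/-- `φ` is smooth, with norm at most `C` in `step M m`. -/
def StepBound (M : WeightSequence) (m : ℝ) (φ : ℝ → ℂ) (C : ℝ) : Prop :=
  ContDiff ℝ ∞ φ ∧ ∀ t, stepTerm M m φ t ≤ C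

lemma StepBound.of_mem {M : WeightSequence} {m : Ioi (0 : ℝ)} {φ : ℝ → ℂ} (h : φ ∈ step M m) :
    StepBound M m φ (stepNorm M m ⟨φ, h⟩) :=
  ⟨h.1, stepTerm_le_stepNorm M m ⟨φ, h⟩⟩

lemma StepBound.mem {M : WeightSequence} {m : Ioi (0 : ℝ)} {φ : ℝ → ℂ} {C : ℝ}
    (h : StepBound M m φ C) : φ ∈ step M m :=
  ⟨h.1, C, by rintro _ ⟨t, rfl⟩; exact h.2 t⟩

lemma StepBound.le {M : WeightSequence} {m : Ioi (0 : ℝ)} {φ : ℝ → ℂ} {C : ℝ}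
    (h : StepBound M m φ C) : stepNorm M m ⟨φ, h.mem⟩ ≤ C :=
  stepNorm_le M m _ h.2

lemma StepBound.add {M : WeightSequence} {m : ℝ} (hm : 0 < m) {φ ψ : ℝ → ℂ} {A B : ℝ}
    (hφ : StepBound M m φ A) (hψ : StepBound M m ψ B) : StepBound M m (φ + ψ) (A + B) :=
  ⟨hφ.1.add hψ.1, fun t => (stepTerm_add M hm hφ.1 hψ.1 t).trans (add_le_add (hφ.2 t) (hψ.2 t))⟩

lemma StepBound.neg {M : WeightSequence} {m : ℝ} {φ : ℝ → ℂ} {A : ℝ}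
    (hφ : StepBound M m φ A) : StepBound M m (-φ) A := by
  refine ⟨hφ.1.neg, fun t => ?_⟩
  have := stepTerm_smul M m (-1) φ t
  simp only [neg_smul, one_smul, norm_neg, norm_one, one_mul] at this
  exact this.trans_le (hφ.2 t)

lemma StepBound.mono {M : WeightSequence} {m m' : ℝ} (hm : 0 < m) (h : m ≤ m') {φ : ℝ → ℂ}
    {A : ℝ} (hφ : StepBound M m' φ A) : StepBound M m φ A :=
  ⟨hφ.1, fun t => (stepTerm_mono M hm h φ t).trans (hφ.2 t)⟩

lemma StepBound.nonneg {M : WeightSequence} {m : ℝ} (hm : 0 < m) {φ : ℝ → ℂ}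
    {A : ℝ} (hφ : StepBound M m φ A) : 0 ≤ A :=
  (stepTerm_nonneg M hm φ (0, 0, 0)).trans (hφ.2 _)

lemma WeightSequence.exists_succ_le (M : WeightSequence) :
    ∃ k B : ℝ, 2 ≤ k ∧ 0 < B ∧ ∀ p, M (p + 1) ≤ B * k ^ (p + 1) * M p := by
  obtain ⟨A, H, hA, hH, h⟩ := M.stable
  refine ⟨max H 2, A * M 1, le_max_right _ _, mul_pos hA (M.pos 1), fun p => ?_⟩
  have h0 := M.pos p
  have h1 := M.pos 1
  have h2 := h (p + 1) p (Nat.le_succ p)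
  rw [Nat.add_sub_cancel_left] at h2
  calc M (p + 1) ≤ A * H ^ (p + 1) * (M p * M 1) := h2
    _ ≤ A * (max H 2) ^ (p + 1) * (M p * M 1) := by gcongr; exact le_max_left _ _
    _ = _ := by ring

lemma WeightSequence.mul_le_succ (M : WeightSequence) (p : ℕ) : M 1 * M p ≤ M (p + 1) := by
  induction p with
  | zero => simp [M.zero_eq_one]
  | succ p ih =>
    have h := M.logConvex (p + 1) (by omega)
    simp only [Nat.add_sub_cancel] at h
    have h0 := M.pos p
    have h1 := M.pos (p + 1)
    have h2 : M p * (M 1 * M (p + 1)) ≤ M p * M (p + 1 + 1) := by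
      calc M p * (M 1 * M (p + 1)) = (M 1 * M p) * M (p + 1) := by ring
        _ ≤ M (p + 1) * M (p + 1) := by gcongr
        _ ≤ M p * M (p + 1 + 1) := by rw [← sq]; exact h
    exact le_of_mul_le_mul_left h2 h0

lemma StepBound.deriv {M : WeightSequence} {k B m : ℝ} (hk : 2 ≤ k) (hB : 0 < B)
    (hkB : ∀ p, M (p + 1) ≤ B * k ^ (p + 1) * M p) (hm : 0 < m) {φ : ℝ → ℂ} {C : ℝ}
    (hφ : StepBound M (k * m) φ C) : StepBound M m (deriv φ) (B / m * C) := by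
  refine ⟨(contDiff_infty_iff_deriv.1 hφ.1).2, ?_⟩
  rintro ⟨a, b, x⟩
  have h := hφ.2 (a + 1, b, x)
  simp only [stepTerm] at h ⊢
  rw [← iteratedDeriv_succ']
  set w := (1 + x ^ 2) ^ ((b : ℝ) / 2) * ‖iteratedDeriv (a + 1) φ x‖ with hw
  have hw0 : 0 ≤ w := by positivity
  have h0 := M.pos a
  have h1 := M.pos (a + 1)
  have h2 := M.pos b
  have hk0 : 0 < k := by linarith
  have key : m ^ (a + b) / (M a * M b)
      ≤ B / m * ((k * m) ^ (a + 1 + b) / (M (a + 1) * M b)) := by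
    rw [div_mul_div_comm, div_le_div_iff₀ (by positivity) (by positivity)]
    have hk1 : k ^ (a + 1) ≤ k ^ (a + 1 + b) := pow_le_pow_right₀ (by linarith) (by omega)
    calc m ^ (a + b) * (m * (M (a + 1) * M b))
        = m ^ (a + 1 + b) * M b * M (a + 1) := by ring
      _ ≤ m ^ (a + 1 + b) * M b * (B * k ^ (a + 1) * M a) := by gcongr; exact hkB a
      _ ≤ m ^ (a + 1 + b) * M b * (B * k ^ (a + 1 + b) * M a) := by gcongr
      _ = B * (k * m) ^ (a + 1 + b) * (M a * M b) := by rw [mul_pow]; ring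
  calc m ^ (a + b) / (M a * M b) * w
      ≤ B / m * ((k * m) ^ (a + 1 + b) / (M (a + 1) * M b)) * w := by gcongr
    _ = B / m * ((k * m) ^ (a + 1 + b) / (M (a + 1) * M b) * w) := by ring
    _ ≤ B / m * C := by gcongr

lemma iteratedDeriv_id_mul {φ : ℝ → ℂ} (hφ : ContDiff ℝ ∞ φ) (n : ℕ) :
    iteratedDeriv (n + 1) (fun x : ℝ => (x : ℂ) * φ x)
      = fun x : ℝ => (x : ℂ) * iteratedDeriv (n + 1) φ x + (n + 1) * iteratedDeriv n φ x := by
  have hd : ∀ (n : ℕ) (x : ℝ),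
      HasDerivAt (iteratedDeriv n φ) (iteratedDeriv (n + 1) φ x) x := fun n x => by
    rw [iteratedDeriv_succ]
    exact (hφ.differentiable_iteratedDeriv n (by exact_mod_cast ENat.natCast_lt_top n) x).hasDerivAt
  have hx : ∀ x : ℝ, HasDerivAt (fun x : ℝ => (x : ℂ)) 1 x := fun x =>
    Complex.ofRealCLM.hasDerivAt
  induction n with
  | zero =>
    funext x
    rw [iteratedDeriv_one]
    have := ((hx x).mul (hd 0 x)).deriv
    simp only [iteratedDeriv_zero] at this
    rw [show (fun x : ℝ => (x : ℂ) * φ x) = (fun x : ℝ => (x : ℂ)) * φ from rfl, this]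
    simp
    ring
  | succ n ih =>
    funext x
    rw [iteratedDeriv_succ, ih]
    have h := (((hx x).mul (hd (n + 1) x)).add ((hd n x).const_mul ((n : ℂ) + 1))).deriv
    refine Eq.trans h ?_
    push_cast
    ring

lemma StepBound.id_mul {M : WeightSequence} {k B m : ℝ} (hk : 2 ≤ k) (hB : 0 < B)
    (hkB : ∀ p, M (p + 1) ≤ B * k ^ (p + 1) * M p) (hm : 0 < m) {φ : ℝ → ℂ} {C : ℝ}
    (hφ : StepBound M (k * m) φ C) :
    StepBound M m (fun x : ℝ => (x : ℂ) * φ x) ((B / m + m / M 1) * C) := by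
  have hk0 : 0 < k := by linarith
  have hC : 0 ≤ C := hφ.nonneg (by positivity)
  have hM1 := M.pos 1
  refine ⟨Complex.ofRealCLM.contDiff.mul hφ.1, ?_⟩
  -- the part in which no derivative falls on `x`
  have first : ∀ (a b : ℕ) (x : ℝ), m ^ (a + b) / (M a * M b) *
      ((1 + x ^ 2) ^ ((b : ℝ) / 2) * (|x| * ‖iteratedDeriv a φ x‖)) ≤ B / m * C := by
    intro a b x
    have h := hφ.2 (a, b + 1, x)
    simp only [stepTerm] at h
    set d := ‖iteratedDeriv a φ x‖ with hd
    have h0 := M.pos a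
    have h1 := M.pos b
    have h2 := M.pos (b + 1)
    have hx : (1 + x ^ 2) ^ ((b : ℝ) / 2) * |x| ≤ (1 + x ^ 2) ^ (((b + 1 : ℕ) : ℝ) / 2) := by
      have e : (((b + 1 : ℕ) : ℝ) / 2) = (b : ℝ) / 2 + 1 / 2 := by push_cast; ring
      rw [e, Real.rpow_add (by positivity), ← Real.sqrt_eq_rpow (1 + x ^ 2)]
      gcongr
      exact Real.abs_le_sqrt (by linarith)
    have key : m ^ (a + b) / (M a * M b)
        ≤ B / m * ((k * m) ^ (a + (b + 1)) / (M a * M (b + 1))) := by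
      rw [div_mul_div_comm, div_le_div_iff₀ (by positivity) (by positivity)]
      have hk1 : k ^ (b + 1) ≤ k ^ (a + (b + 1)) := pow_le_pow_right₀ (by linarith) (by omega)
      calc m ^ (a + b) * (m * (M a * M (b + 1)))
          = m ^ (a + (b + 1)) * M a * M (b + 1) := by ring
        _ ≤ m ^ (a + (b + 1)) * M a * (B * k ^ (b + 1) * M b) := by gcongr; exact hkB b
        _ ≤ m ^ (a + (b + 1)) * M a * (B * k ^ (a + (b + 1)) * M b) := by gcongr
        _ = B * (k * m) ^ (a + (b + 1)) * (M a * M b) := by rw [mul_pow]; ring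
    calc m ^ (a + b) / (M a * M b) * ((1 + x ^ 2) ^ ((b : ℝ) / 2) * (|x| * d))
        = m ^ (a + b) / (M a * M b) * ((1 + x ^ 2) ^ ((b : ℝ) / 2) * |x| * d) := by ring
      _ ≤ B / m * ((k * m) ^ (a + (b + 1)) / (M a * M (b + 1))) *
          ((1 + x ^ 2) ^ (((b + 1 : ℕ) : ℝ) / 2) * d) := by gcongr
      _ = B / m * ((k * m) ^ (a + (b + 1)) / (M a * M (b + 1)) *
          ((1 + x ^ 2) ^ (((b + 1 : ℕ) : ℝ) / 2) * d)) := by ring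
      _ ≤ B / m * C := by gcongr
  rintro ⟨a, b, x⟩
  cases a with
  | zero =>
    have h := first 0 b x
    simp only [stepTerm, iteratedDeriv_zero, norm_mul, Complex.norm_real, Real.norm_eq_abs] at h ⊢
    refine h.trans ?_
    gcongr
    have : 0 < m / M 1 := by positivity
    linarith
  | succ a =>
    have h := first (a + 1) b x
    have h3 := hφ.2 (a, b, x)
    simp only [stepTerm] at h3 ⊢
    rw [iteratedDeriv_id_mul hφ.1]
    have h0 := M.pos a
    have h1 := M.pos b
    have h2 := M.pos (a + 1)
    have hn : ‖(x : ℂ) * iteratedDeriv (a + 1) φ x + ((a : ℂ) + 1) * iteratedDeriv a φ x‖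
        ≤ |x| * ‖iteratedDeriv (a + 1) φ x‖ + ((a : ℝ) + 1) * ‖iteratedDeriv a φ x‖ := by
      refine (norm_add_le _ _).trans (le_of_eq ?_)
      rw [norm_mul, norm_mul, Complex.norm_real, Real.norm_eq_abs]
      congr 2
      have : ((a : ℂ) + 1) = ((a + 1 : ℕ) : ℂ) := by push_cast; ring
      rw [this, Complex.norm_natCast]
      push_cast
      ring
    set d := ‖iteratedDeriv a φ x‖ with hd
    set w := (1 + x ^ 2) ^ ((b : ℝ) / 2) with hw
    have hw0 : 0 ≤ w := by positivity
    have hd0 : 0 ≤ d := norm_nonneg _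
    have key : m ^ (a + 1 + b) / (M (a + 1) * M b) * ((a : ℝ) + 1)
        ≤ m / M 1 * ((k * m) ^ (a + b) / (M a * M b)) := by
      rw [div_mul_div_comm, div_mul_eq_mul_div, div_le_div_iff₀ (by positivity) (by positivity)]
      have ha : ((a : ℝ) + 1) ≤ k ^ (a + b) := by
        have h2a : (a + 1 : ℕ) ≤ 2 ^ a := Nat.lt_two_pow_self
        calc ((a : ℝ) + 1) ≤ 2 ^ a := by exact_mod_cast h2a
          _ ≤ k ^ a := by gcongr
          _ ≤ k ^ (a + b) := pow_le_pow_right₀ (by linarith) (by omega)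
      calc m ^ (a + 1 + b) * ((a : ℝ) + 1) * (M 1 * (M a * M b))
          = m ^ (a + 1 + b) * ((a : ℝ) + 1) * M b * (M 1 * M a) := by ring
        _ ≤ m ^ (a + 1 + b) * k ^ (a + b) * M b * M (a + 1) := by
            gcongr; exact M.mul_le_succ a
        _ = m * (k * m) ^ (a + b) * (M (a + 1) * M b) := by rw [mul_pow]; ring
    calc m ^ (a + 1 + b) / (M (a + 1) * M b) *
          (w * ‖(x : ℂ) * iteratedDeriv (a + 1) φ x + ((a : ℂ) + 1) * iteratedDeriv a φ x‖)
        ≤ m ^ (a + 1 + b) / (M (a + 1) * M b) *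
          (w * (|x| * ‖iteratedDeriv (a + 1) φ x‖ + ((a : ℝ) + 1) * d)) := by gcongr
      _ = m ^ (a + 1 + b) / (M (a + 1) * M b) * (w * (|x| * ‖iteratedDeriv (a + 1) φ x‖))
          + m ^ (a + 1 + b) / (M (a + 1) * M b) * ((a : ℝ) + 1) * (w * d) := by ring
      _ ≤ B / m * C + m / M 1 * ((k * m) ^ (a + b) / (M a * M b)) * (w * d) := by gcongr
      _ = B / m * C + m / M 1 * ((k * m) ^ (a + b) / (M a * M b) * (w * d)) := by ring
      _ ≤ B / m * C + m / M 1 * C := by gcongr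
      _ = (B / m + m / M 1) * C := by ring

/-- `- d² / dx² + x² - 1` maps `step M (k * m)` continuously to `step M m`. -/
lemma StepBound.exists_osc (M : WeightSequence) :
    ∃ k : ℝ, 0 < k ∧ ∀ m : ℝ, 0 < m → ∃ K : ℝ, ∀ (φ : ℝ → ℂ) (C : ℝ),
      StepBound M (k * m) φ C → StepBound M m (oscFun φ) (K * C) := by
  obtain ⟨k, B, hk, hB, hkB⟩ := M.exists_succ_le
  have hk0 : 0 < k := by linarith
  refine ⟨k * k, by positivity, fun m hm => ?_⟩
  have hkm : 0 < k * m := by positivity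
  refine ⟨B / m * (B / (k * m))
    + (B / m + m / M 1) * (B / (k * m) + k * m / M 1) + 1, fun φ C hφ => ?_⟩
  rw [mul_assoc] at hφ
  have hD := ((hφ.deriv hk hB hkB hkm).deriv hk hB hkB hm).neg
  have hX := (hφ.id_mul hk hB hkB hkm).id_mul hk hB hkB hm
  have hI := (hφ.mono hm (by nlinarith [mul_le_mul hk hk (by norm_num) hk0.le])).neg
  have h := (hD.add hm hX).add hm hI
  have e : oscFun φ = -_root_.deriv (_root_.deriv φ)
      + (fun x : ℝ => (x : ℂ) * ((x : ℂ) * φ x)) + -φ := by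
    funext x
    simp only [oscFun, Pi.add_apply, Pi.neg_apply]
    rw [iteratedDeriv_succ, iteratedDeriv_one]
    ring
  rw [e]
  convert h using 1
  ring

lemma oscFun_add {φ ψ : ℝ → ℂ} (hφ : ContDiff ℝ ∞ φ) (hψ : ContDiff ℝ ∞ ψ) :
    oscFun (φ + ψ) = oscFun φ + oscFun ψ := by
  funext x
  have h : iteratedDeriv 2 (φ + ψ) x = iteratedDeriv 2 φ x + iteratedDeriv 2 ψ x :=
    iteratedDeriv_add (contDiff_infty.1 hφ 2).contDiffAt (contDiff_infty.1 hψ 2).contDiffAt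
  simp only [oscFun, Pi.add_apply, h]
  ring

lemma oscFun_smul (c : ℂ) (φ : ℝ → ℂ) : oscFun (c • φ) = c • oscFun φ := by
  funext x
  simp only [oscFun, iteratedDeriv_const_smul_field, Pi.smul_apply, smul_eq_mul]
  ring

/-- `- d² / dx² + x² - 1` as a linear operator on the Roumieu space. -/
def roumieuOscLin (M : WeightSequence) : RoumieuSpace M →ₗ[ℂ] RoumieuSpace M where
  toFun φ := ⟨oscFun φ.toFun, by
    obtain ⟨k, hk, H⟩ := StepBound.exists_osc M
    obtain ⟨m, hm⟩ := φ.exists_mem_step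
    have hm0 : (0 : ℝ) < m := m.2
    obtain ⟨K, hK⟩ := H (m / k) (by positivity)
    have h1 := hK φ.toFun _ (by rw [mul_div_cancel₀ _ hk.ne']; exact StepBound.of_mem hm)
    exact ⟨⟨m / k, div_pos hm0 hk⟩, StepBound.mem h1⟩⟩
  map_add' φ ψ := by
    obtain ⟨m, hm⟩ := φ.exists_mem_step
    obtain ⟨m', hm'⟩ := ψ.exists_mem_step
    exact RoumieuSpace.ext (oscFun_add hm.1 hm'.1)
  map_smul' c φ := RoumieuSpace.ext (oscFun_smul c φ.toFun)

lemma continuous_roumieuOscLin (M : WeightSequence) : Continuous (roumieuOscLin M) := by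
  refine (roumieu_withSeminorms M).continuous_of_continuous_comp _ ?_
  rintro ⟨p, hp⟩
  refine (roumieu_withSeminorms M).continuous_seminorm
    ⟨p.comp (roumieuOscLin M), fun m => ?_⟩
  obtain ⟨k, hk, H⟩ := StepBound.exists_osc M
  have hm0 : (0 : ℝ) < m := m.2
  obtain ⟨K, hK⟩ := H (m / k) (by positivity)
  obtain ⟨C, hC⟩ := hp ⟨m / k, div_pos hm0 hk⟩
  refine ⟨|C| * K, fun φ h => ?_⟩
  have h1 := hK φ.toFun _ (by rw [mul_div_cancel₀ _ hk.ne']; exact StepBound.of_mem h)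
  refine (hC (roumieuOscLin M φ)
    (StepBound.mem (m := ⟨m / k, div_pos hm0 hk⟩) h1)).trans ?_
  rw [mul_assoc]
  exact mul_le_mul (le_abs_self C) (StepBound.le (m := ⟨m / k, div_pos hm0 hk⟩) h1)
    (apply_nonneg _ _) (abs_nonneg C)

/-- `- d² / dx² + x² - 1` as a continuous linear operator on the Roumieu space. -/
def roumieuOsc (M : WeightSequence) : RoumieuSpace M →L[ℂ] RoumieuSpace M :=
  ⟨roumieuOscLin M, continuous_roumieuOscLin M⟩

/-- `- d² / dx² + x² - 1` as a linear operator on the Beurling space. -/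
def beurlingOscLin (M : WeightSequence) : BeurlingSpace M →ₗ[ℂ] BeurlingSpace M where
  toFun φ := ⟨oscFun φ.toFun, by
    obtain ⟨k, hk, H⟩ := StepBound.exists_osc M
    simp only [beurling, Submodule.mem_iInf]
    intro m
    obtain ⟨K, hK⟩ := H m m.2
    exact StepBound.mem (hK _ _ (StepBound.of_mem (φ.mem_step ⟨k * m, mul_pos hk m.2⟩)))⟩
  map_add' φ ψ := BeurlingSpace.ext (oscFun_add (φ.mem_step ⟨1, mem_Ioi.2 one_pos⟩).1
    (ψ.mem_step ⟨1, mem_Ioi.2 one_pos⟩).1)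
  map_smul' c φ := BeurlingSpace.ext (oscFun_smul c φ.toFun)

lemma beurlingSeminorms_apply (M : WeightSequence) (m : Ioi (0 : ℝ)) (φ : BeurlingSpace M) :
    beurlingSeminorms M m φ = stepNorm M m ⟨φ.toFun, φ.mem_step m⟩ := rfl

lemma continuous_beurlingOscLin (M : WeightSequence) : Continuous (beurlingOscLin M) := by
  refine WithSeminorms.continuous_of_isBounded (beurling_withSeminorms M)
    (beurling_withSeminorms M) _ fun m => ?_
  obtain ⟨k, hk, H⟩ := StepBound.exists_osc M
  obtain ⟨K, hK⟩ := H m m.2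
  refine ⟨{⟨k * m, mul_pos hk m.2⟩}, Real.toNNReal K, fun φ => ?_⟩
  rw [Finset.sup_singleton]
  refine (StepBound.le (hK _ _ (StepBound.of_mem
    (φ.mem_step ⟨k * m, mul_pos hk m.2⟩)))).trans ?_
  exact mul_le_mul_of_nonneg_right (Real.le_coe_toNNReal K) (apply_nonneg _ _)

/-- `- d² / dx² + x² - 1` as a continuous linear operator on the Beurling space. -/
def beurlingOsc (M : WeightSequence) : BeurlingSpace M →L[ℂ] BeurlingSpace M :=
  ⟨beurlingOscLin M, continuous_beurlingOscLin M⟩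

/-! ## The dual spaces

The duals are `StrongDual ℂ (RoumieuSpace M)` and `StrongDual ℂ (BeurlingSpace M)`, with the
topology of uniform convergence on bounded sets. -/

/-- `- d² / dx² + x² - 1` on the dual of the Roumieu space, `⟨N T, φ⟩ = ⟨T, N φ⟩`. -/
def roumieuDualOsc (M : WeightSequence) : Module.End ℂ (StrongDual ℂ (RoumieuSpace M)) where
  toFun T := T.comp (roumieuOsc M)
  map_add' _ _ := rfl
  map_smul' _ _ := rfl

/-- `- d² / dx² + x² - 1` on the dual of the Beurling space, `⟨N T, φ⟩ = ⟨T, N φ⟩`. -/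
def beurlingDualOsc (M : WeightSequence) : Module.End ℂ (StrongDual ℂ (BeurlingSpace M)) where
  toFun T := T.comp (beurlingOsc M)
  map_add' _ _ := rfl
  map_smul' _ _ := rfl

lemma StepBound.exists_integral (M : WeightSequence) (f : ℝ →ᵇ ℂ) {m : ℝ} (hm : 0 < m) :
    ∃ K : ℝ, ∀ (φ : ℝ → ℂ) (C : ℝ), StepBound M m φ C →
      Integrable (fun x => f x * φ x) ∧ ‖∫ x, f x * φ x‖ ≤ K * C := by
  have h2 := M.pos 2
  refine ⟨∫ x : ℝ, ‖f‖ * (M 2 / m ^ 2) * (1 + x ^ 2)⁻¹, fun φ C hφ => ?_⟩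
  have hC : 0 ≤ C := hφ.nonneg hm
  have hint : Integrable (fun x : ℝ => ‖f‖ * (M 2 / m ^ 2) * (1 + x ^ 2)⁻¹) :=
    integrable_inv_one_add_sq.const_mul _
  have hb : ∀ x : ℝ, ‖f x * φ x‖ ≤ ‖f‖ * (M 2 / m ^ 2) * (1 + x ^ 2)⁻¹ * C := by
    intro x
    have h := hφ.2 (0, 2, x)
    simp only [stepTerm, M.zero_eq_one, iteratedDeriv_zero, one_mul, zero_add, Nat.cast_ofNat,
      div_self (two_ne_zero' ℝ), Real.rpow_one] at h
    have hx : 0 < 1 + x ^ 2 := by positivity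
    have h' : ‖φ x‖ ≤ M 2 / m ^ 2 * (1 + x ^ 2)⁻¹ * C := by
      calc ‖φ x‖ = M 2 / m ^ 2 * (1 + x ^ 2)⁻¹ * (m ^ 2 / M 2 * ((1 + x ^ 2) * ‖φ x‖)) := by
            field_simp
        _ ≤ _ := by gcongr
    calc ‖f x * φ x‖ = ‖f x‖ * ‖φ x‖ := norm_mul _ _
      _ ≤ ‖f‖ * (M 2 / m ^ 2 * (1 + x ^ 2)⁻¹ * C) := by
          gcongr; exact f.norm_coe_le_norm x
      _ = _ := by ring
  refine ⟨(hint.mul_const C).mono' (f.continuous.mul hφ.1.continuous).aestronglyMeasurable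
    (Filter.Eventually.of_forall hb), ?_⟩
  rw [← integral_mul_const]
  exact norm_integral_le_of_norm_le (hint.mul_const C) (Filter.Eventually.of_forall hb)

lemma integrable_roumieu {M : WeightSequence} (f : ℝ →ᵇ ℂ) (φ : RoumieuSpace M) :
    Integrable (fun x => f x * φ.toFun x) := by
  obtain ⟨m, hm⟩ := φ.exists_mem_step
  obtain ⟨K, hK⟩ := StepBound.exists_integral M f m.2
  exact (hK _ _ (StepBound.of_mem hm)).1

lemma integrable_beurling {M : WeightSequence} (f : ℝ →ᵇ ℂ) (φ : BeurlingSpace M) :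
    Integrable (fun x => f x * φ.toFun x) := by
  obtain ⟨K, hK⟩ := StepBound.exists_integral M f one_pos
  exact (hK _ _ (StepBound.of_mem (φ.mem_step ⟨1, mem_Ioi.2 one_pos⟩))).1

/-- The linear functional `φ ↦ ∫ f φ` on the Roumieu space. -/
def roumieuOfFunLin (M : WeightSequence) (f : ℝ →ᵇ ℂ) : RoumieuSpace M →ₗ[ℂ] ℂ where
  toFun φ := ∫ x, f x * φ.toFun x
  map_add' φ ψ := by
    rw [← integral_add (integrable_roumieu f φ) (integrable_roumieu f ψ)]
    simp [mul_add]
  map_smul' c φ := by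
    rw [RingHom.id_apply, smul_eq_mul, ← integral_const_mul]
    simp [mul_left_comm]

lemma continuous_roumieuOfFunLin (M : WeightSequence) (f : ℝ →ᵇ ℂ) :
    Continuous (roumieuOfFunLin M f) := by
  refine (norm_withSeminorms ℂ ℂ).continuous_of_continuous_comp _ fun _ => ?_
  refine (roumieu_withSeminorms M).continuous_seminorm
    ⟨(normSeminorm ℂ ℂ).comp (roumieuOfFunLin M f), fun m => ?_⟩
  obtain ⟨K, hK⟩ := StepBound.exists_integral M f m.2
  exact ⟨K, fun φ h => (hK _ _ (StepBound.of_mem h)).2⟩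

/-- A bounded continuous function `f` as the element `φ ↦ ∫ f φ` of the dual of the Roumieu
space. -/
def roumieuOfFun (M : WeightSequence) (f : ℝ →ᵇ ℂ) : StrongDual ℂ (RoumieuSpace M) :=
  ⟨roumieuOfFunLin M f, continuous_roumieuOfFunLin M f⟩

/-- The linear functional `φ ↦ ∫ f φ` on the Beurling space. -/
def beurlingOfFunLin (M : WeightSequence) (f : ℝ →ᵇ ℂ) : BeurlingSpace M →ₗ[ℂ] ℂ where
  toFun φ := ∫ x, f x * φ.toFun x
  map_add' φ ψ := by
    rw [← integral_add (integrable_beurling f φ) (integrable_beurling f ψ)]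
    simp [mul_add]
  map_smul' c φ := by
    rw [RingHom.id_apply, smul_eq_mul, ← integral_const_mul]
    simp [mul_left_comm]

lemma continuous_beurlingOfFunLin (M : WeightSequence) (f : ℝ →ᵇ ℂ) :
    Continuous (beurlingOfFunLin M f) := by
  refine WithSeminorms.continuous_of_isBounded (beurling_withSeminorms M)
    (norm_withSeminorms ℂ ℂ) _ fun _ => ?_
  obtain ⟨K, hK⟩ := StepBound.exists_integral M f one_pos
  refine ⟨{⟨1, mem_Ioi.2 one_pos⟩}, Real.toNNReal K, fun φ => ?_⟩
  rw [Finset.sup_singleton]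
  refine (hK _ _ (StepBound.of_mem (φ.mem_step ⟨1, mem_Ioi.2 one_pos⟩))).2.trans ?_
  exact mul_le_mul_of_nonneg_right (Real.le_coe_toNNReal K) (apply_nonneg _ _)

/-- A bounded continuous function `f` as the element `φ ↦ ∫ f φ` of the dual of the Beurling
space. -/
def beurlingOfFun (M : WeightSequence) (f : ℝ →ᵇ ℂ) : StrongDual ℂ (BeurlingSpace M) :=
  ⟨beurlingOfFunLin M f, continuous_beurlingOfFunLin M f⟩

end GelfandShilov

end

/-! The proof is by expansion in the Hermite functions `h n`, which satisfy `N h n = 2 n h n`. Put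
`b n φ = ∫ φ h n`, `a n = T (h n)`, and let `P n = ∑ β, μ ^ (2 β) n ^ β / M (2 β)` (`symbol`) be the
eigenvalue of the operator `∑ β, μ ^ (2 β) / M (2 β) 2 ^ (-β) N ^ β` at `h n`. Then
`f = ∑ a n / P n • h n` solves the equation formally, and two estimates on the scale of the
functions `P` justify this.

* The norm of `h n` in `step M m`, times any power of `n`, is dominated by `P n` if `m` is small
  with respect to `μ` and to the growth of `M` (`exists_stepBound_hermiteC`). The ladder relations
  bound `x ^ b D ^ a h n` by `K ^ p (n + 2) (n ^ (p / 2) + p ^ (p / 2))`, where `p = a + b`; (M.2)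
  and (M.3)'' or (M.3)''' do the rest. This bounds `a n`, and `f` is a uniformly convergent series.
* If `φ` lies in `step M m`, then `b n φ` is `O(n / P n)` if `μ` is small with respect to `m`
  (`exists_norm_hermiteCoeff_mul_symbol_le`). Since `(2 n) ^ β b n φ = b n (N ^ β φ)`, it is enough
  to bound `N ^ β φ` by a multiple of `K ^ β m ^ (-2 β) M (2 β)`, with `K` independent of `m`. The
  commutators are controlled by replacing `M` by a larger sequence (`majorant`), which (M.3)'' and
  (M.3)''' show to be at most a multiple of `2 ^ p M p`.

It follows, with the completeness of the Hermite functions, that `φ = ∑ b n φ • h n` in some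
`step M m'` on which `T` is continuous, hence `T φ = ∑ a n b n φ`. The term of index `β` of the
expansion of `T`, applied to `φ`, is the sum over `n` of `a n b n φ` times the proportion of the
`β`-th term in `P n`. So the expansion converges by dominated convergence
(`hasSum_strongDual_of_dominated`), uniformly over a bounded set of `φ`, on which
`(n + 2) ^ 2 |a n b n φ|` is bounded. In the Roumieu case this last bound holds because the supremum
over `n` is a seminorm with continuous restrictions to the spaces `step M m`; it does not need the
regularity of the inductive limit. In the Roumieu case `T` is bounded on every `step M m`, so that
`μ` may be arbitrary; in the Beurling case `T` is bounded on one of them, which determines `μ`. -/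

namespace GelfandShilov


/-! ### Hermite functions -/

/-- The number `√(n / 2)`, the matrix entry of the position operator in the basis of the Hermite
functions. -/
noncomputable def ladder (n : ℕ) : ℝ := √((n : ℝ) / 2)

lemma ladder_zero : ladder 0 = 0 := by simp [ladder]

lemma ladder_nonneg (n : ℕ) : 0 ≤ ladder n := Real.sqrt_nonneg _

lemma ladder_succ_pos (n : ℕ) : 0 < ladder (n + 1) := by
  unfold ladder
  positivity

lemma ladder_mul_self (n : ℕ) : ladder n * ladder n = (n : ℝ) / 2 :=
  Real.mul_self_sqrt (by positivity)

/-- The Hermite functions, normalized in `L²(ℝ)`, through their three-term recursion. The value of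
`n - 1` at `n = 0` does not matter, since `ladder 0 = 0`. -/
noncomputable def hermiteFun : ℕ → ℝ → ℝ
  | 0, x => (√(√Real.pi))⁻¹ * Real.exp (-x ^ 2 / 2)
  | n + 1, x => (x * hermiteFun n x - ladder n * hermiteFun (n - 1) x) / ladder (n + 1)
  termination_by n => n

lemma hermiteFun_zero (x : ℝ) :
    hermiteFun 0 x = (√(√Real.pi))⁻¹ * Real.exp (-x ^ 2 / 2) := by
  rw [hermiteFun]

lemma hermiteFun_succ (n : ℕ) (x : ℝ) : hermiteFun (n + 1) x
    = (x * hermiteFun n x - ladder n * hermiteFun (n - 1) x) / ladder (n + 1) := by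
  rw [hermiteFun]

lemma id_mul_hermiteFun (n : ℕ) (x : ℝ) : x * hermiteFun n x
    = ladder n * hermiteFun (n - 1) x + ladder (n + 1) * hermiteFun (n + 1) x := by
  rw [hermiteFun_succ, mul_div_cancel₀ _ (ladder_succ_pos n).ne']
  ring

/-- The annihilation operator `x + d/dx` maps the `n`-th Hermite function to a multiple of its
predecessor. -/
lemma hasDerivAt_hermiteFun_lower (n : ℕ) (x : ℝ) : HasDerivAt (hermiteFun n)
    (2 * ladder n * hermiteFun (n - 1) x - x * hermiteFun n x) x := by
  induction n using Nat.strong_induction_on with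
  | _ n ih =>
    rcases n with _ | n
    · rw [show hermiteFun 0 = fun x => (√(√Real.pi))⁻¹ * Real.exp (-x ^ 2 / 2) from
        funext hermiteFun_zero]
      have h := ((((hasDerivAt_id x).pow 2).neg.div_const 2).exp).const_mul ((√(√Real.pi))⁻¹)
      refine h.congr_deriv ?_
      simp [ladder_zero]
      ring
    · rw [show hermiteFun (n + 1) = fun x => (x * hermiteFun n x
        - ladder n * hermiteFun (n - 1) x) / ladder (n + 1) from funext (hermiteFun_succ n)]
      have h := ((((hasDerivAt_id x).mul (ih n (by omega)))).sub
        ((ih (n - 1) (by omega)).const_mul (ladder n))).div_const (ladder (n + 1))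
      refine h.congr_deriv ?_
      have hs := (ladder_succ_pos n).ne'
      simp only [id_eq, Nat.add_sub_cancel]
      field_simp
      have h2 := ladder_mul_self (n + 1)
      push_cast at h2
      rcases n with _ | n
      · simp only [ladder_zero, zero_add, sq] at h2 ⊢
        push_cast at h2
        rw [h2]
        ring
      · have h3 := id_mul_hermiteFun n x
        have h1 := ladder_mul_self (n + 1)
        simp only [Nat.add_sub_cancel]
        push_cast at h1 h2 ⊢
        linear_combination (-2 * hermiteFun (n + 1) x) * h2
          + (2 * hermiteFun (n + 1) x) * h1 + (2 * ladder (n + 1)) * h3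

lemma hasDerivAt_hermiteFun (n : ℕ) (x : ℝ) : HasDerivAt (hermiteFun n)
    (ladder n * hermiteFun (n - 1) x - ladder (n + 1) * hermiteFun (n + 1) x) x := by
  refine (hasDerivAt_hermiteFun_lower n x).congr_deriv ?_
  rw [id_mul_hermiteFun]
  ring

lemma continuous_hermiteFun (n : ℕ) : Continuous (hermiteFun n) :=
  continuous_iff_continuousAt.2 fun x => (hasDerivAt_hermiteFun n x).continuousAt

lemma exists_pow_mul_hermiteFun_le (n k : ℕ) :
    ∃ C : ℝ, ∀ x : ℝ, |x| ^ k * |hermiteFun n x| ≤ C := by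
  induction n using Nat.strong_induction_on generalizing k with
  | _ n ih =>
    rcases n with _ | n
    · refine ⟨k.factorial * Real.exp (1 / 2) * (√(√Real.pi))⁻¹, fun x => ?_⟩
      have h1 : |x| ^ k ≤ k.factorial * Real.exp |x| := by
        have := Real.pow_div_factorial_le_exp |x| (abs_nonneg x) k
        rwa [div_le_iff₀ (by positivity), mul_comm] at this
      have h2 : Real.exp |x| * Real.exp (-x ^ 2 / 2) ≤ Real.exp (1 / 2) := by
        rw [← Real.exp_add]
        gcongr
        nlinarith [sq_nonneg (|x| - 1), sq_abs x]
      rw [hermiteFun_zero, abs_mul, abs_of_nonneg (by positivity : 0 ≤ (√(√Real.pi))⁻¹),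
        Real.abs_exp]
      calc |x| ^ k * ((√(√Real.pi))⁻¹ * Real.exp (-x ^ 2 / 2))
          ≤ (k.factorial * Real.exp |x|) * ((√(√Real.pi))⁻¹ * Real.exp (-x ^ 2 / 2)) := by gcongr
        _ = k.factorial * (Real.exp |x| * Real.exp (-x ^ 2 / 2)) * (√(√Real.pi))⁻¹ := by ring
        _ ≤ _ := by gcongr
    · obtain ⟨A, hA⟩ := ih n (by omega) (k + 1)
      obtain ⟨B, hB⟩ := ih (n - 1) (by omega) k
      refine ⟨(A + ladder n * B) / ladder (n + 1), fun x => ?_⟩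
      have hs := ladder_succ_pos n
      have hn := ladder_nonneg n
      rw [hermiteFun_succ, abs_div, abs_of_pos hs, ← mul_div_assoc]
      gcongr
      calc |x| ^ k * |x * hermiteFun n x - ladder n * hermiteFun (n - 1) x|
          ≤ |x| ^ k * (|x * hermiteFun n x| + |ladder n * hermiteFun (n - 1) x|) := by
            gcongr; exact abs_sub _ _
        _ = |x| ^ (k + 1) * |hermiteFun n x| + ladder n * (|x| ^ k * |hermiteFun (n - 1) x|) := by
            rw [abs_mul, abs_mul, abs_of_nonneg hn]; ring
        _ ≤ A + ladder n * B := by gcongr; exacts [hA x, hB x]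

lemma integrable_of_sq_decay {E : Type*} [NormedAddCommGroup E] {f : ℝ → E} (hf : Continuous f)
    {C : ℝ} (h : ∀ x, (1 + x ^ 2) * ‖f x‖ ≤ C) : Integrable f := by
  refine (integrable_inv_one_add_sq.const_mul C).mono' hf.aestronglyMeasurable
    (Filter.Eventually.of_forall fun x => ?_)
  rw [← div_eq_mul_inv, le_div_iff₀ (by positivity), mul_comm]
  exact h x

lemma integrable_pow_mul_hermiteFun (n k : ℕ) : Integrable (fun x => x ^ k * hermiteFun n x) := by
  obtain ⟨A, hA⟩ := exists_pow_mul_hermiteFun_le n k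
  obtain ⟨B, hB⟩ := exists_pow_mul_hermiteFun_le n (k + 2)
  refine integrable_of_sq_decay ((continuous_pow k).mul (continuous_hermiteFun n))
    (C := A + B) fun x => ?_
  have h1 := hA x
  have h2 := hB x
  rw [pow_add, sq_abs] at h2
  rw [Real.norm_eq_abs, abs_mul, abs_pow]
  linarith

lemma integrable_hermiteFun (n : ℕ) : Integrable (hermiteFun n) := by
  simpa using integrable_pow_mul_hermiteFun n 0

lemma integrable_hermiteFun_mul (n k : ℕ) :
    Integrable (fun x => hermiteFun n x * hermiteFun k x) := by
  obtain ⟨A, hA⟩ := exists_pow_mul_hermiteFun_le k 0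
  exact (integrable_hermiteFun n).mul_bdd (c := A)
    (continuous_hermiteFun k).aestronglyMeasurable
    (Filter.Eventually.of_forall fun x => by simpa using hA x)

lemma integral_deriv_hermiteFun_mul (n k : ℕ) :
    ∫ x, (ladder n * hermiteFun (n - 1) x - ladder (n + 1) * hermiteFun (n + 1) x)
      * hermiteFun k x
    = -∫ x, hermiteFun n x *
      (ladder k * hermiteFun (k - 1) x - ladder (k + 1) * hermiteFun (k + 1) x) := by
  have h := integral_mul_deriv_eq_deriv_mul_of_integrable (u := hermiteFun n) (v := hermiteFun k)
    (fun x _ => hasDerivAt_hermiteFun n x) (fun x _ => hasDerivAt_hermiteFun k x)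
    (by
      have := ((integrable_hermiteFun_mul n (k - 1)).const_mul (ladder k)).sub
        ((integrable_hermiteFun_mul n (k + 1)).const_mul (ladder (k + 1)))
      refine this.congr (Filter.Eventually.of_forall fun x => ?_)
      simp only [Pi.sub_apply, Pi.mul_apply]
      ring)
    (by
      have := ((integrable_hermiteFun_mul (n - 1) k).const_mul (ladder n)).sub
        ((integrable_hermiteFun_mul (n + 1) k).const_mul (ladder (n + 1)))
      refine this.congr (Filter.Eventually.of_forall fun x => ?_)
      simp only [Pi.sub_apply, Pi.mul_apply]
      ring)
    (integrable_hermiteFun_mul n k)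
  rw [h, neg_neg]

lemma integral_hermiteFun_mul_succ (n k : ℕ) :
    ladder (k + 1) * ∫ x, hermiteFun n x * hermiteFun (k + 1) x
      = ladder n * ∫ x, hermiteFun (n - 1) x * hermiteFun k x := by
  have h := integral_deriv_hermiteFun_mul n k
  have hx : ∫ x, (ladder n * hermiteFun (n - 1) x + ladder (n + 1) * hermiteFun (n + 1) x)
      * hermiteFun k x = ∫ x, hermiteFun n x *
      (ladder k * hermiteFun (k - 1) x + ladder (k + 1) * hermiteFun (k + 1) x) := by
    congr 1
    funext x
    rw [← id_mul_hermiteFun, ← id_mul_hermiteFun]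
    ring
  simp only [sub_mul, mul_sub, add_mul, mul_add] at h hx
  simp only [mul_assoc, mul_left_comm (hermiteFun n _)] at h hx
  have i1 := (integrable_hermiteFun_mul (n - 1) k).const_mul (ladder n)
  have i2 := (integrable_hermiteFun_mul (n + 1) k).const_mul (ladder (n + 1))
  have i3 := (integrable_hermiteFun_mul n (k - 1)).const_mul (ladder k)
  have i4 := (integrable_hermiteFun_mul n (k + 1)).const_mul (ladder (k + 1))
  rw [integral_sub i1 i2, integral_sub i3 i4] at h
  rw [integral_add i1 i2, integral_add i3 i4] at hx
  simp only [integral_const_mul] at h hx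
  linarith

lemma integral_hermiteFun_zero_sq : ∫ x, hermiteFun 0 x * hermiteFun 0 x = 1 := by
  have e : ∀ x, hermiteFun 0 x * hermiteFun 0 x = (√Real.pi)⁻¹ * Real.exp (-1 * x ^ 2) := by
    intro x
    rw [hermiteFun_zero, mul_mul_mul_comm, ← Real.exp_add, ← mul_inv,
      Real.mul_self_sqrt (Real.sqrt_nonneg _)]
    congr 2
    ring
  simp only [e]
  rw [integral_const_mul, integral_gaussian, div_one]
  exact inv_mul_cancel₀ (by positivity)

/-- Orthonormality of the Hermite functions. -/
lemma integral_hermiteFun_mul (n k : ℕ) :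
    ∫ x, hermiteFun n x * hermiteFun k x = if n = k then 1 else 0 := by
  induction k generalizing n with
  | zero =>
    rcases n with _ | n
    · simpa using integral_hermiteFun_zero_sq
    · have h := integral_hermiteFun_mul_succ 0 n
      rw [ladder_zero, zero_mul] at h
      have h' := (mul_eq_zero.1 h).resolve_left (ladder_succ_pos n).ne'
      simpa [mul_comm] using h'
  | succ k ih =>
    have h := integral_hermiteFun_mul_succ n k
    have hk := (ladder_succ_pos k).ne'
    rcases n with _ | n
    · rw [ladder_zero, zero_mul] at h
      simpa using (mul_eq_zero.1 h).resolve_left hk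
    · rw [Nat.add_sub_cancel, ih] at h
      by_cases e : n = k
      · subst e
        simpa using mul_left_cancel₀ hk (h.trans (by simp))
      · simp only [e, if_false, mul_zero] at h
        simpa [e] using (mul_eq_zero.1 h).resolve_left hk

lemma integral_deriv_hermiteFun_sq (n : ℕ) :
    ∫ x, (ladder n * hermiteFun (n - 1) x - ladder (n + 1) * hermiteFun (n + 1) x) ^ 2
      = n + 1 / 2 := by
  have e : ∀ x, (ladder n * hermiteFun (n - 1) x - ladder (n + 1) * hermiteFun (n + 1) x) ^ 2
      = (ladder n * ladder n) * (hermiteFun (n - 1) x * hermiteFun (n - 1) x)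
        - (2 * ladder n * ladder (n + 1)) * (hermiteFun (n - 1) x * hermiteFun (n + 1) x)
        + (ladder (n + 1) * ladder (n + 1)) * (hermiteFun (n + 1) x * hermiteFun (n + 1) x) :=
    fun x => by ring
  have i1 := (integrable_hermiteFun_mul (n - 1) (n - 1)).const_mul (ladder n * ladder n)
  have i2 := (integrable_hermiteFun_mul (n - 1) (n + 1)).const_mul (2 * ladder n * ladder (n + 1))
  have i3 := (integrable_hermiteFun_mul (n + 1) (n + 1)).const_mul
    (ladder (n + 1) * ladder (n + 1))
  simp only [e]
  have h := integral_add (i1.sub i2) i3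
  simp only [Pi.sub_apply] at h
  rw [h, integral_sub i1 i2]
  simp only [integral_const_mul, integral_hermiteFun_mul, ladder_mul_self]
  rw [if_neg (show ¬ n - 1 = n + 1 by omega)]
  push_cast
  simp
  ring

/-- Sobolev's inequality `|h|² ≤ ∫ (h² + h'²)` on the line gives a polynomial bound in `n`, which
is all that is needed; the Hermite functions are in fact uniformly bounded. -/
lemma abs_hermiteFun_le (n : ℕ) (x : ℝ) : |hermiteFun n x| ≤ n + 2 := by
  set d : ℝ → ℝ :=
    fun x => ladder n * hermiteFun (n - 1) x - ladder (n + 1) * hermiteFun (n + 1) x with hd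
  -- otherwise the integral would be `0`, against the formula for it
  have hint : Integrable (fun x => d x ^ 2) := by
    by_contra hc
    have := integral_deriv_hermiteFun_sq n
    rw [integral_undef hc] at this
    have : (0 : ℝ) ≤ n := n.cast_nonneg
    linarith
  have hint2 := integrable_hermiteFun_mul n n
  have hder : ∀ y, HasDerivAt (fun y => hermiteFun n y * hermiteFun n y)
      (2 * (hermiteFun n y * d y)) y := fun y =>
    ((hasDerivAt_hermiteFun n y).mul (hasDerivAt_hermiteFun n y)).congr_deriv (by ring)
  have hle : ∀ y, ‖2 * (hermiteFun n y * d y)‖ ≤ hermiteFun n y * hermiteFun n y + d y ^ 2 := by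
    intro y
    rw [Real.norm_eq_abs, abs_le]
    constructor <;> nlinarith [sq_nonneg (hermiteFun n y + d y), sq_nonneg (hermiteFun n y - d y)]
  have hdc : Continuous d := by
    have h1 := continuous_hermiteFun (n - 1)
    have h2 := continuous_hermiteFun (n + 1)
    fun_prop
  have hdi : Integrable (fun y => 2 * (hermiteFun n y * d y)) :=
    (hint2.add hint).mono' (by
      have := continuous_hermiteFun n
      exact (by fun_prop : Continuous _).aestronglyMeasurable) (Filter.Eventually.of_forall hle)
  have hlim : Filter.Tendsto (fun y => hermiteFun n y * hermiteFun n y) Filter.atBot (nhds 0) :=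
    tendsto_zero_of_hasDerivAt_of_integrableOn_Iic (a := x) (fun y _ => hder y)
      hdi.integrableOn hint2.integrableOn
  have hftc := integral_Iic_of_hasDerivAt_of_tendsto' (a := x) (fun y _ => hder y)
    hdi.integrableOn hlim
  have hbd : hermiteFun n x * hermiteFun n x ≤ n + 3 / 2 := by
    rw [sub_zero] at hftc
    rw [← hftc]
    calc ∫ y in Iic x, 2 * (hermiteFun n y * d y)
        ≤ ∫ y in Iic x, ‖2 * (hermiteFun n y * d y)‖ :=
          (Real.le_norm_self _).trans (norm_integral_le_integral_norm _)
      _ ≤ ∫ y, ‖2 * (hermiteFun n y * d y)‖ :=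
          setIntegral_le_integral hdi.norm (Filter.Eventually.of_forall fun y => norm_nonneg _)
      _ ≤ ∫ y, (hermiteFun n y * hermiteFun n y + d y ^ 2) :=
          integral_mono hdi.norm (hint2.add hint) hle
      _ = n + 3 / 2 := by
          rw [integral_add hint2 hint, integral_hermiteFun_mul, integral_deriv_hermiteFun_sq]
          simp
          ring
  have hn : (0 : ℝ) ≤ n := n.cast_nonneg
  refine abs_le_of_sq_le_sq ?_ (by positivity)
  nlinarith


/-! ### Completeness of the Hermite functions -/

lemma integrable_mul_pow_mul_hermiteFun {g : ℝ → ℂ} (hg : Continuous g) {K : ℝ}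
    (hK : ∀ x, ‖g x‖ ≤ K) (k n : ℕ) :
    Integrable (fun x => g x * ((x ^ k * hermiteFun n x : ℝ) : ℂ)) :=
  (integrable_pow_mul_hermiteFun n k).ofReal.bdd_mul (c := K) hg.aestronglyMeasurable
    (Filter.Eventually.of_forall hK)

/-- A bounded function orthogonal to all Hermite functions has vanishing moments against the
Gaussian weight. -/
lemma integral_mul_pow_mul_hermiteFun_eq_zero {g : ℝ → ℂ} (hg : Continuous g) {K : ℝ}
    (hK : ∀ x, ‖g x‖ ≤ K) (h0 : ∀ n, ∫ x, g x * (hermiteFun n x : ℂ) = 0) (k n : ℕ) :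
    ∫ x, g x * ((x ^ k * hermiteFun n x : ℝ) : ℂ) = 0 := by
  induction k generalizing n with
  | zero => simpa using h0 n
  | succ k ih =>
    have e : ∀ x, g x * ((x ^ (k + 1) * hermiteFun n x : ℝ) : ℂ)
        = (ladder n : ℂ) * (g x * ((x ^ k * hermiteFun (n - 1) x : ℝ) : ℂ))
          + (ladder (n + 1) : ℂ) * (g x * ((x ^ k * hermiteFun (n + 1) x : ℝ) : ℂ)) := by
      intro x
      rw [pow_succ, mul_assoc, id_mul_hermiteFun]
      push_cast
      ring
    simp only [e]
    rw [integral_add ((integrable_mul_pow_mul_hermiteFun hg hK k _).const_mul _)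
      ((integrable_mul_pow_mul_hermiteFun hg hK k _).const_mul _), integral_const_mul,
      integral_const_mul, ih, ih]
    simp

lemma integrable_exp_mul_hermiteFun_zero (c : ℝ) :
    Integrable (fun x : ℝ => Real.exp (c * |x|) * hermiteFun 0 x) := by
  refine integrable_of_sq_decay (by have := continuous_hermiteFun 0; fun_prop)
    (C := 2 * Real.exp ((c + 1) ^ 2 / 2) * (√(√Real.pi))⁻¹) fun x => ?_
  have h1 : 1 + x ^ 2 ≤ 2 * Real.exp |x| := by
    have := Real.quadratic_le_exp_of_nonneg (abs_nonneg x)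
    rw [sq_abs] at this
    linarith [abs_nonneg x]
  have h2 : Real.exp |x| * Real.exp (c * |x|) * Real.exp (-x ^ 2 / 2)
      ≤ Real.exp ((c + 1) ^ 2 / 2) := by
    rw [← Real.exp_add, ← Real.exp_add]
    gcongr
    nlinarith [sq_nonneg (|x| - (c + 1)), sq_abs x]
  rw [hermiteFun_zero, Real.norm_eq_abs, abs_of_nonneg (by positivity)]
  calc (1 + x ^ 2) * (Real.exp (c * |x|) * ((√(√Real.pi))⁻¹ * Real.exp (-x ^ 2 / 2)))
      ≤ (2 * Real.exp |x|) * (Real.exp (c * |x|) * ((√(√Real.pi))⁻¹ * Real.exp (-x ^ 2 / 2))) := by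
        gcongr
    _ = 2 * (Real.exp |x| * Real.exp (c * |x|) * Real.exp (-x ^ 2 / 2)) * (√(√Real.pi))⁻¹ := by
        ring
    _ ≤ _ := by gcongr

open scoped FourierTransform in
/-- The Hermite functions are complete: expanding the exponential in the Fourier transform of
`g` times the Gaussian, all terms are moments, hence vanish. -/
lemma eq_zero_of_integral_mul_hermiteFun {g : ℝ → ℂ} (hg : Continuous g) {K : ℝ}
    (hK : ∀ x, ‖g x‖ ≤ K) (h0 : ∀ n, ∫ x, g x * (hermiteFun n x : ℂ) = 0) : g = 0 := by
  set u : ℝ → ℂ := fun x => g x * (hermiteFun 0 x : ℂ) with hu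
  have hpos : ∀ x, 0 < hermiteFun 0 x := fun x => by rw [hermiteFun_zero]; positivity
  have hK0 : 0 ≤ K := (norm_nonneg _).trans (hK 0)
  have huc : Continuous u := hg.mul (Complex.continuous_ofReal.comp (continuous_hermiteFun 0))
  have hui : Integrable u := by
    simpa using integrable_mul_pow_mul_hermiteFun hg hK 0 0
  have hF : 𝓕 u = 0 := by
    funext w
    rw [Real.fourier_real_eq_integral_exp_smul]
    set c : ℝ := 2 * Real.pi * |w| with hc
    have hexp : ∀ x : ℝ, HasSum (fun k : ℕ => (c * |x|) ^ k / k.factorial) (Real.exp (c * |x|)) := by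
      intro x
      rw [Real.exp_eq_exp_ℝ]
      exact NormedSpace.expSeries_div_hasSum_exp _
    -- integrate the exponential series term by term
    have key := hasSum_integral_of_dominated_convergence (μ := volume)
      (F := fun (k : ℕ) (x : ℝ) => (((-2 * Real.pi * x * w : ℝ) : ℂ) * Complex.I) ^ k
        / k.factorial * u x)
      (f := fun x => Complex.exp (((-2 * Real.pi * x * w : ℝ) : ℂ) * Complex.I) • u x)
      (fun k x => (c * |x|) ^ k / k.factorial * (K * hermiteFun 0 x))
      (fun k => (by fun_prop : Continuous _).aestronglyMeasurable)
      (fun k => Filter.Eventually.of_forall fun x => by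
        have hn : ‖((-2 * Real.pi * x * w : ℝ) : ℂ) * Complex.I‖ = c * |x| := by
          rw [norm_mul, Complex.norm_I, mul_one, Complex.norm_real, Real.norm_eq_abs, abs_mul,
            abs_mul, abs_mul, abs_neg, abs_two, abs_of_pos Real.pi_pos, hc]
          ring
        rw [norm_mul, norm_div, norm_pow, hn, Complex.norm_natCast, hu, norm_mul,
          Complex.norm_real, Real.norm_of_nonneg (hpos x).le]
        have := (hpos x).le
        gcongr
        exact hK x)
      (Filter.Eventually.of_forall fun x => (hexp x).summable.mul_right _)
      (by
        have := (integrable_exp_mul_hermiteFun_zero c).const_mul K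
        refine this.congr (Filter.Eventually.of_forall fun x => ?_)
        simp only []
        rw [((hexp x).mul_right _).tsum_eq]
        ring)
      (Filter.Eventually.of_forall fun x => by
        have : HasSum (fun k : ℕ => (((-2 * Real.pi * x * w : ℝ) : ℂ) * Complex.I) ^ k
            / k.factorial) (Complex.exp (((-2 * Real.pi * x * w : ℝ) : ℂ) * Complex.I)) := by
          rw [Complex.exp_eq_exp_ℂ]
          exact NormedSpace.expSeries_div_hasSum_exp _
        exact this.mul_right _)
    have hz : ∀ k : ℕ, ∫ x, (((-2 * Real.pi * x * w : ℝ) : ℂ) * Complex.I) ^ k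
        / k.factorial * u x = 0 := by
      intro k
      have e : ∀ x : ℝ, (((-2 * Real.pi * x * w : ℝ) : ℂ) * Complex.I) ^ k
          / k.factorial * u x = (((-2 * Real.pi * w : ℝ) : ℂ) * Complex.I) ^ k / k.factorial
            * (g x * ((x ^ k * hermiteFun 0 x : ℝ) : ℂ)) := by
        intro x
        simp only [hu]
        push_cast
        ring
      simp only [e]
      rw [integral_const_mul, integral_mul_pow_mul_hermiteFun_eq_zero hg hK h0, mul_zero]
    simp only [hz] at key
    exact key.unique hasSum_zero
  have hinv := huc.fourierInv_fourier_eq hui (by rw [hF]; exact integrable_zero _ _ _)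
  rw [hF] at hinv
  funext x
  have hx : u x = 0 := by
    rw [← hinv, Real.fourierInv_eq]
    simp
  exact (mul_eq_zero.1 hx).resolve_right (by exact_mod_cast (hpos x).ne')


/-! ### Weight sequences and the symbol of the operator -/

/-- The conditions (M.3)'' and (M.3)''' at a fixed `L`: up to a constant, `L ^ p * M p` dominates
`√p ^ p = p ^ (p / 2)`. -/
def WeightSequence.GrowthAt (M : WeightSequence) (L : ℝ) : Prop :=
  ∃ C : ℝ, 0 < C ∧ ∀ p : ℕ, √(p : ℝ) ^ p ≤ C * L ^ p * M p

lemma rpow_half_eq_sqrt_pow (p : ℕ) : (p : ℝ) ^ ((p : ℝ) / 2) = √(p : ℝ) ^ p := by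
  rw [Real.sqrt_eq_rpow, ← Real.rpow_natCast, ← Real.rpow_mul p.cast_nonneg]
  congr 1
  ring

lemma WeightSequence.NontrivialRoumieu.exists_growthAt {M : WeightSequence}
    (h : M.NontrivialRoumieu) : ∃ L : ℝ, 0 < L ∧ M.GrowthAt L := by
  obtain ⟨C, L, hC, hL, h⟩ := h
  exact ⟨L, hL, C, hC, fun p => by rw [← rpow_half_eq_sqrt_pow]; exact h p⟩

lemma WeightSequence.NontrivialBeurling.growthAt {M : WeightSequence}
    (h : M.NontrivialBeurling) {L : ℝ} (hL : 0 < L) : M.GrowthAt L := by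
  obtain ⟨C, hC, h⟩ := h L hL
  refine ⟨max C 1, by positivity, fun p => ?_⟩
  have hp := M.pos p
  rcases Nat.eq_zero_or_pos p with rfl | hp1
  · simp [M.zero_eq_one]
  · rw [← rpow_half_eq_sqrt_pow]
    refine (h p hp1).trans ?_
    gcongr
    exact le_max_left _ _

lemma WeightSequence.succ_mul_le (M : WeightSequence) {q p : ℕ} (h : q ≤ p) :
    M (q + 1) * M p ≤ M q * M (p + 1) := by
  induction p, h using Nat.le_induction with
  | base => rw [mul_comm]
  | succ p _ ih =>
    have h1 := M.logConvex (p + 1) (by omega)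
    simp only [Nat.add_sub_cancel] at h1
    have hp := M.pos p
    have hp1 := M.pos (p + 1)
    have hq := M.pos q
    refine le_of_mul_le_mul_left ?_ hp
    calc M p * (M (q + 1) * M (p + 1)) = (M (q + 1) * M p) * M (p + 1) := by ring
      _ ≤ (M q * M (p + 1)) * M (p + 1) := by gcongr
      _ = M q * M (p + 1) ^ 2 := by ring
      _ ≤ M q * (M p * M (p + 1 + 1)) := by gcongr
      _ = _ := by ring

lemma WeightSequence.mul_le_add (M : WeightSequence) (q r : ℕ) : M q * M r ≤ M (q + r) := by
  induction q with
  | zero => simp [M.zero_eq_one]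
  | succ q ih =>
    have hq := M.pos q
    have hq1 := M.pos (q + 1)
    refine le_of_mul_le_mul_left ?_ hq
    calc M q * (M (q + 1) * M r) = M (q + 1) * (M q * M r) := by ring
      _ ≤ M (q + 1) * M (q + r) := by gcongr
      _ ≤ M q * M (q + r + 1) := M.succ_mul_le (Nat.le_add_right q r)
      _ = M q * M (q + 1 + r) := by rw [Nat.add_right_comm]

/-- The condition (M.2), with given constants. -/
def WeightSequence.StableWith (M : WeightSequence) (A H : ℝ) : Prop :=
  0 < A ∧ 0 < H ∧ ∀ p q : ℕ, M (p + q) ≤ A * H ^ (p + q) * (M p * M q)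

lemma WeightSequence.exists_stableWith (M : WeightSequence) : ∃ A H : ℝ, M.StableWith A H := by
  obtain ⟨A, H, hA, hH, h⟩ := M.stable
  exact ⟨A, H, hA, hH, fun p q => by simpa using h (p + q) p (Nat.le_add_right p q)⟩

/-- The `β`-th term of the series `symbol M μ n`. -/
noncomputable def symbolTerm (M : WeightSequence) (μ : ℝ) (n β : ℕ) : ℝ :=
  μ ^ (2 * β) * (n : ℝ) ^ β / M (2 * β)

/-- The eigenvalue `∑ μ ^ (2 β) n ^ β / M (2 β)` of the operator
`∑ μ ^ (2 β) / M (2 β) * 2 ^ (-β) * N ^ β` at the `n`-th Hermite function. -/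
noncomputable def symbol (M : WeightSequence) (μ : ℝ) (n : ℕ) : ℝ := ∑' β, symbolTerm M μ n β

lemma symbolTerm_nonneg (M : WeightSequence) (μ : ℝ) (n β : ℕ) : 0 ≤ symbolTerm M μ n β := by
  have := M.pos (2 * β)
  unfold symbolTerm
  rw [pow_mul]
  positivity

lemma symbolTerm_mono (M : WeightSequence) {μ ν : ℝ} (hμ : 0 ≤ μ) (h : μ ≤ ν) (n β : ℕ) :
    symbolTerm M μ n β ≤ symbolTerm M ν n β := by
  have := M.pos (2 * β)
  unfold symbolTerm
  gcongr

lemma summable_symbolTerm {M : WeightSequence} {L : ℝ} (hM : M.GrowthAt L) (μ : ℝ) (n : ℕ) :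
    Summable (symbolTerm M μ n) := by
  obtain ⟨C, hC, h⟩ := hM
  refine Summable.of_nonneg_of_le (symbolTerm_nonneg M μ n) (fun β => ?_)
    ((Real.summable_pow_div_factorial (L ^ 2 * μ ^ 2 * n)).mul_left C)
  have hp := M.pos (2 * β)
  have hf : (β.factorial : ℝ) ≤ C * L ^ (2 * β) * M (2 * β) := by
    refine le_trans ?_ (h (2 * β))
    rw [pow_mul, Real.sq_sqrt (by positivity)]
    calc (β.factorial : ℝ) ≤ (β : ℝ) ^ β := by exact_mod_cast Nat.factorial_le_pow β
      _ ≤ _ := by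
        gcongr
        linarith [(Nat.cast_nonneg β : (0 : ℝ) ≤ β)]
  unfold symbolTerm
  rw [← mul_div_assoc, div_le_div_iff₀ hp (by positivity)]
  calc μ ^ (2 * β) * (n : ℝ) ^ β * β.factorial
      ≤ μ ^ (2 * β) * (n : ℝ) ^ β * (C * L ^ (2 * β) * M (2 * β)) := by
        rw [pow_mul μ]
        gcongr
    _ = _ := by rw [mul_pow, mul_pow, ← pow_mul, ← pow_mul]; ring

lemma symbolTerm_le_symbol {M : WeightSequence} {L : ℝ} (hM : M.GrowthAt L) (μ : ℝ) (n β : ℕ) :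
    symbolTerm M μ n β ≤ symbol M μ n :=
  (summable_symbolTerm hM μ n).le_tsum β fun _ _ => symbolTerm_nonneg M μ n _

lemma one_le_symbol {M : WeightSequence} {L : ℝ} (hM : M.GrowthAt L) (μ : ℝ) (n : ℕ) :
    1 ≤ symbol M μ n := by
  refine le_trans ?_ (symbolTerm_le_symbol hM μ n 0)
  simp [symbolTerm, M.zero_eq_one]

lemma symbol_mono {M : WeightSequence} {L : ℝ} (hM : M.GrowthAt L) {μ ν : ℝ} (hμ : 0 ≤ μ)
    (h : μ ≤ ν) (n : ℕ) : symbol M μ n ≤ symbol M ν n :=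
  (summable_symbolTerm hM μ n).tsum_le_tsum (symbolTerm_mono M hμ h n)
    (summable_symbolTerm hM ν n)

lemma pow_div_le_symbol_of_even {M : WeightSequence} {A H L s : ℝ} (hM : M.GrowthAt L)
    (hH : M.StableWith A H) (hs : 0 < s) {n j p d β : ℕ} (hβ : p + d = 2 * β)
    (hn : (n : ℝ) ^ j * √(n : ℝ) ^ p ≤ √(n : ℝ) ^ (p + d)) :
    (n : ℝ) ^ j * ((s * √(n : ℝ)) ^ p / M p) ≤ A * M d / s ^ d * symbol M (H * s) n := by
  obtain ⟨hA, hH0, h⟩ := hH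
  have hp := M.pos p
  have hd := M.pos d
  have hpd := M.pos (p + d)
  have h1 : 1 / M p ≤ A * H ^ (p + d) * M d / M (p + d) := by
    rw [div_le_div_iff₀ hp hpd, one_mul]
    calc M (p + d) ≤ _ := h p d
      _ = _ := by ring
  have h2 := symbolTerm_le_symbol hM (H * s) n β
  have e : symbolTerm M (H * s) n β = (H * s) ^ (p + d) * √(n : ℝ) ^ (p + d) / M (p + d) := by
    rw [hβ, symbolTerm, pow_mul (√(n : ℝ)), Real.sq_sqrt (by positivity)]
  calc (n : ℝ) ^ j * ((s * √(n : ℝ)) ^ p / M p)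
      = s ^ p * ((n : ℝ) ^ j * √(n : ℝ) ^ p) * (1 / M p) := by rw [mul_pow]; ring
    _ ≤ s ^ p * √(n : ℝ) ^ (p + d) * (A * H ^ (p + d) * M d / M (p + d)) := by gcongr
    _ = A * M d / s ^ d * symbolTerm M (H * s) n β := by
        rw [e, mul_pow H s, pow_add s]
        field_simp
    _ ≤ _ := by gcongr

/-- A power of `n` is absorbed into the symbol at the cost of enlarging the parameter `s` to
`H * s`, with `H` from (M.2). -/
lemma exists_pow_mul_pow_div_le_symbol {M : WeightSequence} {A H L s : ℝ} (hM : M.GrowthAt L)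
    (hH : M.StableWith A H) (hs : 0 < s) (j : ℕ) :
    ∃ K : ℝ, 0 < K ∧ ∀ n p : ℕ,
      (n : ℝ) ^ j * ((s * √(n : ℝ)) ^ p / M p) ≤ K * symbol M (H * s) n := by
  have hA := hH.1
  have hd := M.pos (2 * j)
  have hd1 := M.pos (2 * j + 1)
  refine ⟨A * M (2 * j) / s ^ (2 * j) + A * M (2 * j + 1) / s ^ (2 * j + 1), by positivity,
    fun n p => ?_⟩
  have hw := zero_le_one.trans (one_le_symbol hM (H * s) n)
  have hsq : √(n : ℝ) ^ (2 * j) = (n : ℝ) ^ j := by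
    rw [pow_mul, Real.sq_sqrt (by positivity)]
  rw [add_mul]
  rcases Nat.even_or_odd p with ⟨q, hq⟩ | ⟨q, hq⟩
  · refine (pow_div_le_symbol_of_even hM hH hs (d := 2 * j) (β := q + j) (by omega) ?_).trans
      (le_add_of_nonneg_right (by positivity))
    rw [pow_add, hsq, mul_comm]
  · refine (pow_div_le_symbol_of_even hM hH hs (d := 2 * j + 1) (β := q + j + 1)
      (by omega) ?_).trans (le_add_of_nonneg_left (by positivity))
    rcases Nat.eq_zero_or_pos n with rfl | hn
    · simp [hq]
    · have : 1 ≤ √(n : ℝ) := Real.one_le_sqrt.2 (by exact_mod_cast hn)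
      rw [pow_add, pow_succ, hsq]
      calc (n : ℝ) ^ j * √(n : ℝ) ^ p = √(n : ℝ) ^ p * ((n : ℝ) ^ j * 1) := by ring
        _ ≤ _ := by gcongr

lemma exists_add_two_pow_mul_pow_div_le_symbol {M : WeightSequence} {A H L s : ℝ}
    (hM : M.GrowthAt L) (hH : M.StableWith A H) (hs : 0 < s) (j : ℕ) :
    ∃ K : ℝ, 0 < K ∧ ∀ n p : ℕ,
      ((n : ℝ) + 2) ^ j * ((s * √(n : ℝ)) ^ p / M p) ≤ K * symbol M (H * s) n := by
  obtain ⟨K, hK, h⟩ := exists_pow_mul_pow_div_le_symbol hM hH hs j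
  obtain ⟨K', hK', h'⟩ := exists_pow_mul_pow_div_le_symbol hM hH hs 0
  refine ⟨2 ^ (j - 1) * (K + 2 ^ j * K'), by positivity, fun n p => ?_⟩
  have hp := M.pos p
  have h1 := h n p
  have h2 := h' n p
  rw [pow_zero, one_mul] at h2
  calc ((n : ℝ) + 2) ^ j * ((s * √(n : ℝ)) ^ p / M p)
      ≤ (2 ^ (j - 1) * ((n : ℝ) ^ j + 2 ^ j)) * ((s * √(n : ℝ)) ^ p / M p) := by
        gcongr
        exact add_pow_le (by positivity) (by positivity) j
    _ = 2 ^ (j - 1) * ((n : ℝ) ^ j * ((s * √(n : ℝ)) ^ p / M p)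
        + 2 ^ j * ((s * √(n : ℝ)) ^ p / M p)) := by ring
    _ ≤ 2 ^ (j - 1) * (K * symbol M (H * s) n + 2 ^ j * (K' * symbol M (H * s) n)) := by gcongr
    _ = _ := by ring

/-! ### The Hermite functions as test functions -/

/-- The Hermite functions as complex-valued functions. -/
noncomputable def hermiteC (n : ℕ) (x : ℝ) : ℂ := hermiteFun n x

lemma hasDerivAt_hermiteC (n : ℕ) (x : ℝ) : HasDerivAt (hermiteC n)
    (ladder n * hermiteC (n - 1) x - ladder (n + 1) * hermiteC (n + 1) x) x := by
  refine (hasDerivAt_hermiteFun n x).ofReal_comp.congr_deriv ?_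
  simp [hermiteC]

lemma id_mul_hermiteC (n : ℕ) (x : ℝ) : (x : ℂ) * hermiteC n x
    = ladder n * hermiteC (n - 1) x + ladder (n + 1) * hermiteC (n + 1) x := by
  simp only [hermiteC]
  exact_mod_cast id_mul_hermiteFun n x

lemma contDiff_hermiteC (n : ℕ) : ContDiff ℝ ∞ (hermiteC n) := by
  suffices h : ∀ (k n : ℕ), ContDiff ℝ k (hermiteC n) from contDiff_infty.2 fun k => h k n
  intro k
  induction k with
  | zero =>
    exact fun n => contDiff_zero.2 (continuous_iff_continuousAt.2
      fun x => (hasDerivAt_hermiteC n x).continuousAt)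
  | succ k ih =>
    intro n
    push_cast
    refine contDiff_succ_iff_deriv.2 ⟨fun x => (hasDerivAt_hermiteC n x).differentiableAt,
      by simp, ?_⟩
    rw [show deriv (hermiteC n) = fun x => ladder n * hermiteC (n - 1) x
      - ladder (n + 1) * hermiteC (n + 1) x from funext fun x => (hasDerivAt_hermiteC n x).deriv]
    exact (contDiff_const.mul (ih _)).sub (contDiff_const.mul (ih _))

lemma iteratedDeriv_succ_hermiteC (a n : ℕ) (x : ℝ) : iteratedDeriv (a + 1) (hermiteC n) x
    = ladder n * iteratedDeriv a (hermiteC (n - 1)) x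
      - ladder (n + 1) * iteratedDeriv a (hermiteC (n + 1)) x := by
  have hc : ∀ k, ContDiffAt ℝ a (hermiteC k) x := fun k =>
    (contDiff_infty.1 (contDiff_hermiteC k) a).contDiffAt
  rw [iteratedDeriv_succ', show deriv (hermiteC n) = (fun x => (ladder n : ℂ) * hermiteC (n - 1) x)
      - fun x => (ladder (n + 1) : ℂ) * hermiteC (n + 1) x from
      funext fun x => (hasDerivAt_hermiteC n x).deriv,
    iteratedDeriv_sub (contDiffAt_const.mul (hc _)) (contDiffAt_const.mul (hc _)),
    iteratedDeriv_const_mul_field, iteratedDeriv_const_mul_field]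

/-- A bound for the result of applying `p` factors, each multiplication by `1 + |x|` or
differentiation, to the `n`-th Hermite function. -/
noncomputable def hermiteBound (p n : ℕ) : ℝ := √(6 * ((n : ℝ) + p + 1)) ^ p * (n + p + 2)

lemma hermiteBound_mono (p : ℕ) {n k : ℕ} (h : n ≤ k) : hermiteBound p n ≤ hermiteBound p k := by
  unfold hermiteBound
  gcongr

lemma ladder_add_mul_hermiteBound_le (p n : ℕ) :
    (1 + ladder n + ladder (n + 1)) * hermiteBound p (n + 1) ≤ hermiteBound (p + 1) n := by
  have h0 : ladder n ≤ ladder (n + 1) := by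
    unfold ladder; gcongr; omega
  have h1 := ladder_mul_self (n + 1)
  have hl := ladder_nonneg (n + 1)
  have hn : (0 : ℝ) ≤ n := n.cast_nonneg
  have hp : (0 : ℝ) ≤ p := p.cast_nonneg
  have h2 : 1 + ladder n + ladder (n + 1) ≤ √(6 * ((n : ℝ) + (p + 1) + 1)) := by
    refine (by linarith : _ ≤ 1 + 2 * ladder (n + 1)).trans ?_
    refine Real.le_sqrt_of_sq_le ?_
    push_cast at h1
    nlinarith [sq_nonneg (ladder (n + 1) - 1)]
  unfold hermiteBound
  push_cast
  rw [pow_succ, show (n : ℝ) + 1 + p + 1 = n + (p + 1) + 1 by ring,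
    show (n : ℝ) + 1 + p + 2 = n + (p + 1) + 2 by ring]
  calc _ ≤ √(6 * ((n : ℝ) + (p + 1) + 1)) *
        (√(6 * ((n : ℝ) + (p + 1) + 1)) ^ p * ((n : ℝ) + (p + 1) + 2)) := by gcongr
    _ = _ := by ring

lemma norm_hermiteC_le (n : ℕ) (x : ℝ) : ‖hermiteC n x‖ ≤ n + 2 := by
  simpa [hermiteC] using abs_hermiteFun_le n x

lemma pow_mul_norm_hermiteC_le (b n : ℕ) (x : ℝ) :
    (1 + |x|) ^ b * ‖hermiteC n x‖ ≤ hermiteBound b n := by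
  induction b generalizing n with
  | zero => simpa [hermiteBound] using norm_hermiteC_le n x
  | succ b ih =>
    have h1 := ladder_nonneg n
    have h2 := ladder_nonneg (n + 1)
    have hx : |x| * ‖hermiteC n x‖ ≤ ladder n * ‖hermiteC (n - 1) x‖
        + ladder (n + 1) * ‖hermiteC (n + 1) x‖ := by
      have := norm_add_le ((ladder n : ℂ) * hermiteC (n - 1) x)
        (ladder (n + 1) * hermiteC (n + 1) x)
      rw [← id_mul_hermiteC] at this
      simpa [abs_of_nonneg h1, abs_of_nonneg h2] using this
    calc (1 + |x|) ^ (b + 1) * ‖hermiteC n x‖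
        = (1 + |x|) ^ b * (‖hermiteC n x‖ + |x| * ‖hermiteC n x‖) := by ring
      _ ≤ (1 + |x|) ^ b * (‖hermiteC n x‖ + (ladder n * ‖hermiteC (n - 1) x‖
          + ladder (n + 1) * ‖hermiteC (n + 1) x‖)) := by gcongr
      _ = (1 + |x|) ^ b * ‖hermiteC n x‖ + ladder n * ((1 + |x|) ^ b * ‖hermiteC (n - 1) x‖)
          + ladder (n + 1) * ((1 + |x|) ^ b * ‖hermiteC (n + 1) x‖) := by ring
      _ ≤ hermiteBound b (n + 1) + ladder n * hermiteBound b (n + 1)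
          + ladder (n + 1) * hermiteBound b (n + 1) := by
          gcongr
          · exact (ih n).trans (hermiteBound_mono b (by omega))
          · exact (ih _).trans (hermiteBound_mono b (by omega))
          · exact ih _
      _ = (1 + ladder n + ladder (n + 1)) * hermiteBound b (n + 1) := by ring
      _ ≤ _ := ladder_add_mul_hermiteBound_le b n

lemma pow_mul_norm_iteratedDeriv_hermiteC_le (a b n : ℕ) (x : ℝ) :
    (1 + |x|) ^ b * ‖iteratedDeriv a (hermiteC n) x‖ ≤ hermiteBound (a + b) n := by
  induction a generalizing n with
  | zero => simpa using pow_mul_norm_hermiteC_le b n x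
  | succ a ih =>
    have h1 := ladder_nonneg n
    have h2 := ladder_nonneg (n + 1)
    have hx : ‖iteratedDeriv (a + 1) (hermiteC n) x‖
        ≤ ladder n * ‖iteratedDeriv a (hermiteC (n - 1)) x‖
        + ladder (n + 1) * ‖iteratedDeriv a (hermiteC (n + 1)) x‖ := by
      rw [iteratedDeriv_succ_hermiteC]
      refine (norm_sub_le _ _).trans (le_of_eq ?_)
      simp [abs_of_nonneg h1, abs_of_nonneg h2]
    have hb : 0 ≤ hermiteBound (a + b) (n + 1) := by unfold hermiteBound; positivity
    calc (1 + |x|) ^ b * ‖iteratedDeriv (a + 1) (hermiteC n) x‖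
        ≤ (1 + |x|) ^ b * (ladder n * ‖iteratedDeriv a (hermiteC (n - 1)) x‖
        + ladder (n + 1) * ‖iteratedDeriv a (hermiteC (n + 1)) x‖) := by gcongr
      _ = ladder n * ((1 + |x|) ^ b * ‖iteratedDeriv a (hermiteC (n - 1)) x‖)
        + ladder (n + 1) * ((1 + |x|) ^ b * ‖iteratedDeriv a (hermiteC (n + 1)) x‖) := by ring
      _ ≤ ladder n * hermiteBound (a + b) (n + 1)
          + ladder (n + 1) * hermiteBound (a + b) (n + 1) := by
          gcongr
          · exact (ih _).trans (hermiteBound_mono _ (by omega))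
          · exact ih _
      _ ≤ (1 + ladder n + ladder (n + 1)) * hermiteBound (a + b) (n + 1) := by
          linarith
      _ ≤ hermiteBound (a + b + 1) n := ladder_add_mul_hermiteBound_le (a + b) n
      _ = _ := by rw [Nat.add_right_comm]

lemma hermiteBound_le (p n : ℕ) :
    hermiteBound p n ≤ 9 ^ p * (n + 2) * (√(n : ℝ) ^ p + √(p : ℝ) ^ p) := by
  rcases Nat.eq_zero_or_pos p with rfl | hp
  · have : (0 : ℝ) ≤ n := n.cast_nonneg
    simp only [hermiteBound, pow_zero, Nat.cast_zero]
    linarith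
  · have h1 : √(6 * ((n : ℝ) + p + 1)) ≤ 9 / 2 * max √(n : ℝ) √(p : ℝ) := by
      rw [Real.sqrt_le_iff]
      refine ⟨by positivity, ?_⟩
      have hp1 : (1 : ℝ) ≤ p := by exact_mod_cast hp
      have e1 := Real.sq_sqrt (Nat.cast_nonneg n : (0 : ℝ) ≤ n)
      have e2 := Real.sq_sqrt (Nat.cast_nonneg p : (0 : ℝ) ≤ p)
      have l1 := pow_le_pow_left₀ (Real.sqrt_nonneg n) (le_max_left √(n : ℝ) √(p : ℝ)) 2
      have l2 := pow_le_pow_left₀ (Real.sqrt_nonneg p) (le_max_right √(n : ℝ) √(p : ℝ)) 2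
      rw [mul_pow]
      linarith
    have h2 : (n : ℝ) + p + 2 ≤ (n + 2) * 2 ^ p := by
      have : ((p : ℝ) + 1) ≤ 2 ^ p := by exact_mod_cast Nat.lt_two_pow_self
      nlinarith [(Nat.cast_nonneg n : (0 : ℝ) ≤ n), (Nat.cast_nonneg p : (0 : ℝ) ≤ p)]
    have h3 : max √(n : ℝ) √(p : ℝ) ^ p ≤ √(n : ℝ) ^ p + √(p : ℝ) ^ p := by
      rcases max_choice √(n : ℝ) √(p : ℝ) with h | h <;> rw [h]
      · exact le_add_of_nonneg_right (by positivity)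
      · exact le_add_of_nonneg_left (by positivity)
    unfold hermiteBound
    calc √(6 * ((n : ℝ) + p + 1)) ^ p * (n + p + 2)
        ≤ (9 / 2 * max √(n : ℝ) √(p : ℝ)) ^ p * ((n + 2) * 2 ^ p) := by gcongr
      _ = (9 / 2 * 2) ^ p * (n + 2) * max √(n : ℝ) √(p : ℝ) ^ p := by
          rw [mul_pow, mul_pow]; ring
      _ ≤ _ := by norm_num; gcongr

lemma stepTerm_hermiteC_le {M : WeightSequence} {A H m : ℝ} (hH : M.StableWith A H) (hm : 0 < m)
    (n a b : ℕ) (x : ℝ) : stepTerm M m (hermiteC n) (a, b, x)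
      ≤ A * (n + 2) * ((9 * H * m) ^ (a + b) * (√(n : ℝ) ^ (a + b)
        + √((a + b : ℕ) : ℝ) ^ (a + b)) / M (a + b)) := by
  obtain ⟨hA, hH0, h⟩ := hH
  have ha := M.pos a
  have hb := M.pos b
  have hab := M.pos (a + b)
  have h1 : 1 / (M a * M b) ≤ A * H ^ (a + b) / M (a + b) := by
    rw [div_le_div_iff₀ (by positivity) hab, one_mul]
    exact h a b
  have hx : (1 + x ^ 2) ^ ((b : ℝ) / 2) ≤ (1 + |x|) ^ b := by
    rw [div_eq_mul_one_div, mul_comm, Real.rpow_mul (by positivity), ← Real.sqrt_eq_rpow,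
      Real.rpow_natCast]
    gcongr
    rw [Real.sqrt_le_iff]
    refine ⟨by positivity, ?_⟩
    nlinarith [abs_nonneg x, sq_abs x]
  have h2 := (pow_mul_norm_iteratedDeriv_hermiteC_le a b n x).trans (hermiteBound_le (a + b) n)
  unfold stepTerm
  simp only []
  calc m ^ (a + b) / (M a * M b) * ((1 + x ^ 2) ^ ((b : ℝ) / 2)
        * ‖iteratedDeriv a (hermiteC n) x‖)
      ≤ m ^ (a + b) / (M a * M b) * ((1 + |x|) ^ b * ‖iteratedDeriv a (hermiteC n) x‖) := by
        gcongr
    _ = m ^ (a + b) * (1 / (M a * M b)) * ((1 + |x|) ^ b * ‖iteratedDeriv a (hermiteC n) x‖) := by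
        ring
    _ ≤ m ^ (a + b) * (A * H ^ (a + b) / M (a + b)) * (9 ^ (a + b) * (n + 2) *
        (√(n : ℝ) ^ (a + b) + √((a + b : ℕ) : ℝ) ^ (a + b))) := by gcongr
    _ = _ := by rw [mul_pow, mul_pow]; ring

/-- The norm of a Hermite function in `step M m` is smaller than the symbol, by any power of
`n`, provided that `m` is small with respect to the growth of `M` and to `μ`. -/
lemma exists_stepBound_hermiteC {M : WeightSequence} {A H L m μ : ℝ} (hM : M.GrowthAt L)
    (hH : M.StableWith A H) (hL : 0 < L) (hm : 0 < m) (hmL : 9 * H * m * L ≤ 1)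
    (hμ : H * (9 * H * m) ≤ μ) (j : ℕ) :
    ∃ K : ℝ, 0 < K ∧ ∀ n : ℕ, StepBound M m (hermiteC n) (K * symbol M μ n / (n + 2) ^ j) := by
  obtain ⟨hA, hH0, -⟩ := id hH
  have hs : 0 < 9 * H * m := by positivity
  obtain ⟨K, hK, h⟩ := exists_add_two_pow_mul_pow_div_le_symbol hM hH hs (j + 1)
  obtain ⟨C, hC, hg⟩ := id hM
  refine ⟨A * (K + C * K), by positivity, fun n => ⟨contDiff_hermiteC n, ?_⟩⟩
  rintro ⟨a, b, x⟩
  rw [le_div_iff₀ (by positivity)]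
  have hab := M.pos (a + b)
  have h1 := h n (a + b)
  have h0 := h n 0
  rw [pow_zero, M.zero_eq_one, div_one, mul_one] at h0
  have h2 : (9 * H * m) ^ (a + b) * √((a + b : ℕ) : ℝ) ^ (a + b) / M (a + b) ≤ C := by
    rw [div_le_iff₀ hab]
    calc (9 * H * m) ^ (a + b) * √((a + b : ℕ) : ℝ) ^ (a + b)
        ≤ (9 * H * m) ^ (a + b) * (C * L ^ (a + b) * M (a + b)) := by gcongr; exact hg _
      _ = C * M (a + b) * (9 * H * m * L) ^ (a + b) := by rw [mul_pow _ L]; ring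
      _ ≤ C * M (a + b) * 1 := by
          gcongr
          exact pow_le_one₀ (by positivity) hmL
      _ = _ := by ring
  calc stepTerm M m (hermiteC n) (a, b, x) * ((n : ℝ) + 2) ^ j
      ≤ A * (n + 2) * ((9 * H * m) ^ (a + b) * (√(n : ℝ) ^ (a + b)
        + √((a + b : ℕ) : ℝ) ^ (a + b)) / M (a + b)) * ((n : ℝ) + 2) ^ j := by
        gcongr; exact stepTerm_hermiteC_le hH hm n a b x
    _ = A * (((n : ℝ) + 2) ^ (j + 1) * ((9 * H * m * √(n : ℝ)) ^ (a + b) / M (a + b))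
        + ((9 * H * m) ^ (a + b) * √((a + b : ℕ) : ℝ) ^ (a + b) / M (a + b))
          * ((n : ℝ) + 2) ^ (j + 1)) := by rw [mul_pow _ √(n : ℝ)]; ring
    _ ≤ A * (K * symbol M (H * (9 * H * m)) n + C * (K * symbol M (H * (9 * H * m)) n)) := by
        gcongr
    _ = A * (K + C * K) * symbol M (H * (9 * H * m)) n := by ring
    _ ≤ _ := by
        gcongr
        exact symbol_mono hM (by positivity) hμ n


/-! ### Iterates of the operator on test functions -/

/-- The least sequence `G ≥ M` with `√(p + 1) * G p ≤ L * G (p + 1)`. Unlike `M`, it controls the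
commutators of multiplication by `x` and differentiation with the constant `L` and no others. -/
noncomputable def majorant (M : WeightSequence) (L : ℝ) : ℕ → ℝ
  | 0 => 1
  | p + 1 => max (M (p + 1)) (√((p : ℝ) + 1) / L * majorant M L p)

lemma le_majorant (M : WeightSequence) (L : ℝ) (p : ℕ) : M p ≤ majorant M L p := by
  cases p with
  | zero => exact M.zero_eq_one.le
  | succ p => exact le_max_left _ _

lemma majorant_pos (M : WeightSequence) (L : ℝ) (p : ℕ) : 0 < majorant M L p :=
  (M.pos p).trans_le (le_majorant M L p)

lemma sqrt_mul_majorant_le (M : WeightSequence) {L : ℝ} (hL : 0 < L) (p : ℕ) :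
    √((p : ℝ) + 1) * majorant M L p ≤ L * majorant M L (p + 1) := by
  have h : √((p : ℝ) + 1) / L * majorant M L p ≤ majorant M L (p + 1) := le_max_right _ _
  rwa [div_mul_eq_mul_div, div_le_iff₀ hL, mul_comm _ L] at h

lemma exists_majorant_eq (M : WeightSequence) (L : ℝ) (p : ℕ) :
    ∃ j k : ℕ, j + k = p ∧
      majorant M L p = M j * √((j + 1).ascFactorial k : ℝ) / L ^ k := by
  induction p with
  | zero => exact ⟨0, 0, rfl, by simp [majorant, M.zero_eq_one]⟩
  | succ p ih =>
    rcases max_choice (M (p + 1)) (√((p : ℝ) + 1) / L * majorant M L p) with h | h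
    · exact ⟨p + 1, 0, rfl, by rw [majorant, h]; simp⟩
    · obtain ⟨j, k, hjk, e⟩ := ih
      refine ⟨j, k + 1, by omega, ?_⟩
      rw [majorant, h, e, Nat.ascFactorial_succ, Nat.cast_mul,
        Real.sqrt_mul (by positivity), show j + 1 + k = p + 1 by omega]
      push_cast
      rw [div_mul_div_comm, pow_succ']
      ring

lemma exists_majorant_le {M : WeightSequence} {L : ℝ} (hL : 0 < L) (hM : M.GrowthAt L) :
    ∃ C : ℝ, 0 < C ∧ ∀ p, majorant M L p ≤ C * 2 ^ p * M p := by
  obtain ⟨C, hC, h⟩ := hM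
  refine ⟨C, hC, fun p => ?_⟩
  obtain ⟨j, k, rfl, e⟩ := exists_majorant_eq M L p
  have hj := M.pos j
  have hk := M.pos k
  have h1 : √((j + 1).ascFactorial k : ℝ) ≤ √(k : ℝ) ^ k * 2 ^ (j + k) := by
    rw [Real.sqrt_le_iff]
    refine ⟨by positivity, ?_⟩
    rw [Nat.ascFactorial_eq_factorial_mul_choose, mul_pow, ← pow_mul, mul_comm k 2, pow_mul,
      Real.sq_sqrt (by positivity), Nat.cast_mul]
    have hf : (k.factorial : ℝ) ≤ (k : ℝ) ^ k := by exact_mod_cast Nat.factorial_le_pow k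
    have hc : ((j + k).choose k : ℝ) ≤ 2 ^ (j + k) := by
      exact_mod_cast Nat.choose_le_two_pow (j + k) k
    have h2 : (1 : ℝ) ≤ 2 ^ (j + k) := one_le_pow₀ one_le_two
    calc (k.factorial : ℝ) * ((j + k).choose k : ℝ) ≤ (k : ℝ) ^ k * (2 ^ (j + k) * 1) := by
          rw [mul_one]; gcongr
      _ ≤ (k : ℝ) ^ k * (2 ^ (j + k)) ^ 2 := by rw [sq]; gcongr
  rw [e, div_le_iff₀ (by positivity)]
  calc M j * √((j + 1).ascFactorial k : ℝ) ≤ M j * (C * L ^ k * M k * 2 ^ (j + k)) := by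
        gcongr
        refine h1.trans ?_
        gcongr
        exact h k
    _ = C * 2 ^ (j + k) * (M j * M k) * L ^ k := by ring
    _ ≤ _ := by
      gcongr
      exact M.mul_le_add j k

/-- A nonnegative sequence growing fast enough to absorb the factors `a` which arise when `a`
derivatives fall on a product with `x`. -/
def OscAdmissible (W : ℕ → ℝ) : Prop :=
  (∀ p, 0 ≤ W p) ∧ ∀ p : ℕ, ((p : ℝ) + 1) * W p ≤ W (p + 2)

lemma OscAdmissible.le {W : ℕ → ℝ} (hW : OscAdmissible W) (p : ℕ) : W p ≤ W (p + 2) := by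
  refine le_trans ?_ (hW.2 p)
  exact le_mul_of_one_le_left (hW.1 p) (by linarith [(Nat.cast_nonneg p : (0 : ℝ) ≤ p)])

lemma oscAdmissible_majorant (M : WeightSequence) {L R : ℝ} (hL : 0 < L) (hR : L ≤ R) :
    OscAdmissible (fun p => R ^ p * majorant M L p) := by
  have hR0 : 0 < R := hL.trans_le hR
  refine ⟨fun p => by have := majorant_pos M L p; positivity, fun p => ?_⟩
  have h0 := majorant_pos M L p
  have h2 := majorant_pos M L (p + 2)
  have key : ((p : ℝ) + 1) * majorant M L p ≤ R ^ 2 * majorant M L (p + 2) := by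
    have e1 := sqrt_mul_majorant_le M hL p
    have e2 := sqrt_mul_majorant_le M hL (p + 1)
    push_cast at e2
    calc ((p : ℝ) + 1) * majorant M L p
        = √((p : ℝ) + 1) * (√((p : ℝ) + 1) * majorant M L p) := by
          rw [← mul_assoc, Real.mul_self_sqrt (by positivity)]
      _ ≤ √((p : ℝ) + 1 + 1) * (L * majorant M L (p + 1)) := by gcongr; linarith
      _ = L * (√((p : ℝ) + 1 + 1) * majorant M L (p + 1)) := by ring
      _ ≤ L * (L * majorant M L (p + 1 + 1)) := by gcongr
      _ ≤ R * (R * majorant M L (p + 2)) := by gcongr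
      _ = _ := by ring
  calc ((p : ℝ) + 1) * (R ^ p * majorant M L p)
      = R ^ p * (((p : ℝ) + 1) * majorant M L p) := by ring
    _ ≤ R ^ p * (R ^ 2 * majorant M L (p + 2)) := by gcongr
    _ = _ := by ring

/-- `φ` is smooth with `|x| ^ b * |φ^(a) (x)| ≤ A * W (a + b + p)`. Applying to `φ` a differentiation
or a multiplication by `x` raises `p` by one. -/
def Majorized (W : ℕ → ℝ) (p : ℕ) (A : ℝ) (φ : ℝ → ℂ) : Prop :=
  ContDiff ℝ ∞ φ ∧ ∀ (a b : ℕ) (x : ℝ), |x| ^ b * ‖iteratedDeriv a φ x‖ ≤ A * W (a + b + p)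

lemma StepBound.majorized {M : WeightSequence} {m C : ℝ} (hm : 0 < m) {φ : ℝ → ℂ}
    (h : StepBound M m φ C) (L : ℝ) :
    Majorized (fun p => (1 / m) ^ p * majorant M L p) 0 C φ := by
  refine ⟨h.1, fun a b x => ?_⟩
  have hC := h.nonneg hm
  have h1 := h.2 (a, b, x)
  have ha := M.pos a
  have hb := M.pos b
  have hx : |x| ^ b ≤ (1 + x ^ 2) ^ ((b : ℝ) / 2) := by
    rw [div_eq_mul_one_div, mul_comm (b : ℝ), Real.rpow_mul (by positivity), ← Real.sqrt_eq_rpow,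
      Real.rpow_natCast]
    gcongr
    exact Real.abs_le_sqrt (by linarith)
  simp only [stepTerm] at h1
  rw [div_mul_eq_mul_div, div_le_iff₀ (by positivity)] at h1
  simp only []
  rw [add_zero, one_div, inv_pow, inv_mul_eq_div, ← mul_div_assoc, le_div_iff₀ (by positivity)]
  calc |x| ^ b * ‖iteratedDeriv a φ x‖ * m ^ (a + b)
      ≤ (1 + x ^ 2) ^ ((b : ℝ) / 2) * ‖iteratedDeriv a φ x‖ * m ^ (a + b) := by gcongr
    _ = m ^ (a + b) * ((1 + x ^ 2) ^ ((b : ℝ) / 2) * ‖iteratedDeriv a φ x‖) := by ring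
    _ ≤ C * (M a * M b) := h1
    _ ≤ C * majorant M L (a + b) := by
        gcongr
        exact (M.mul_le_add a b).trans (le_majorant M L _)

namespace Majorized

variable {W : ℕ → ℝ} {p : ℕ} {A B : ℝ} {φ ψ : ℝ → ℂ}

lemma neg (h : Majorized W p A φ) : Majorized W p A (-φ) := by
  refine ⟨h.1.neg, fun a b x => ?_⟩
  rw [iteratedDeriv_neg, norm_neg]
  exact h.2 a b x

lemma add (h : Majorized W p A φ) (h' : Majorized W p B ψ) : Majorized W p (A + B) (φ + ψ) := by
  refine ⟨h.1.add h'.1, fun a b x => ?_⟩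
  rw [iteratedDeriv_add (contDiff_infty.1 h.1 a).contDiffAt (contDiff_infty.1 h'.1 a).contDiffAt,
    add_mul]
  refine le_trans ?_ (add_le_add (h.2 a b x) (h'.2 a b x))
  rw [← mul_add]
  gcongr
  exact norm_add_le _ _

lemma deriv (h : Majorized W p A φ) : Majorized W (p + 1) A (deriv φ) := by
  refine ⟨(contDiff_infty_iff_deriv.1 h.1).2, fun a b x => ?_⟩
  rw [← iteratedDeriv_succ', show a + b + (p + 1) = a + 1 + b + p by ring]
  exact h.2 (a + 1) b x

lemma add_two (hW : OscAdmissible W) (hA : 0 ≤ A) (h : Majorized W p A φ) :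
    Majorized W (p + 2) A φ :=
  ⟨h.1, fun a b x => (h.2 a b x).trans (mul_le_mul_of_nonneg_left (hW.le _) hA)⟩

lemma id_mul (hW : OscAdmissible W) (hA : 0 ≤ A) (h : Majorized W p A φ) :
    Majorized W (p + 1) (2 * A) (fun x : ℝ => (x : ℂ) * φ x) := by
  refine ⟨Complex.ofRealCLM.contDiff.mul h.1, fun a b x => ?_⟩
  cases a with
  | zero =>
    have h1 := h.2 0 (b + 1) x
    have h2 := hW.1 (0 + b + (p + 1))
    rw [show 0 + (b + 1) + p = 0 + b + (p + 1) by ring] at h1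
    simp only [iteratedDeriv_zero, norm_mul, Complex.norm_real, Real.norm_eq_abs] at h1 ⊢
    calc |x| ^ b * (|x| * ‖φ x‖) = |x| ^ (b + 1) * ‖φ x‖ := by ring
      _ ≤ A * W (0 + b + (p + 1)) := h1
      _ ≤ _ := by nlinarith [mul_nonneg hA h2]
  | succ a =>
    have h1 := h.2 (a + 1) (b + 1) x
    have h2 := h.2 a b x
    have h3 := hW.2 (a + b + p)
    have h4 := hW.1 (a + b + p)
    rw [show a + 1 + (b + 1) + p = a + b + p + 2 by ring] at h1
    rw [iteratedDeriv_id_mul h.1, show a + 1 + b + (p + 1) = a + b + p + 2 by ring]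
    have hn : ‖(x : ℂ) * iteratedDeriv (a + 1) φ x + ((a : ℂ) + 1) * iteratedDeriv a φ x‖
        ≤ |x| * ‖iteratedDeriv (a + 1) φ x‖ + ((a : ℝ) + 1) * ‖iteratedDeriv a φ x‖ := by
      refine (norm_add_le _ _).trans (le_of_eq ?_)
      rw [norm_mul, norm_mul, Complex.norm_real, Real.norm_eq_abs,
        show ((a : ℂ) + 1) = ((a + 1 : ℕ) : ℂ) by push_cast; ring, Complex.norm_natCast]
      push_cast
      ring
    calc |x| ^ b * ‖(x : ℂ) * iteratedDeriv (a + 1) φ x + ((a : ℂ) + 1) * iteratedDeriv a φ x‖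
        ≤ |x| ^ b * (|x| * ‖iteratedDeriv (a + 1) φ x‖ + ((a : ℝ) + 1) * ‖iteratedDeriv a φ x‖) := by
          gcongr
      _ = |x| ^ (b + 1) * ‖iteratedDeriv (a + 1) φ x‖
          + ((a : ℝ) + 1) * (|x| ^ b * ‖iteratedDeriv a φ x‖) := by ring
      _ ≤ A * W (a + b + p + 2) + (((a + b + p : ℕ) : ℝ) + 1) * (A * W (a + b + p)) := by
          gcongr
          exact_mod_cast (by omega : a ≤ a + b + p)
      _ = A * W (a + b + p + 2) + A * ((((a + b + p : ℕ) : ℝ) + 1) * W (a + b + p)) := by ring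
      _ ≤ A * W (a + b + p + 2) + A * W (a + b + p + 2) := by gcongr
      _ = _ := by ring

end Majorized

lemma oscFun_eq (φ : ℝ → ℂ) : oscFun φ = -deriv (deriv φ)
      + (fun x : ℝ => (x : ℂ) * ((x : ℂ) * φ x)) + -φ := by
  funext x
  simp only [oscFun, Pi.add_apply, Pi.neg_apply]
  rw [iteratedDeriv_succ, iteratedDeriv_one]
  ring

lemma Majorized.osc {W : ℕ → ℝ} {p : ℕ} {A : ℝ} {φ : ℝ → ℂ} (hW : OscAdmissible W) (hA : 0 ≤ A)
    (h : Majorized W p A φ) : Majorized W (p + 2) (6 * A) (oscFun φ) := by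
  rw [oscFun_eq, show 6 * A = A + 2 * (2 * A) + A by ring]
  exact (h.deriv.deriv.neg.add ((h.id_mul hW hA).id_mul hW (by positivity))).add
    (h.add_two hW hA).neg

lemma Majorized.osc_iterate {W : ℕ → ℝ} {A : ℝ} {φ : ℝ → ℂ} (hW : OscAdmissible W)
    (hA : 0 ≤ A) (h : Majorized W 0 A φ) (β : ℕ) :
    Majorized W (2 * β) (6 ^ β * A) (oscFun^[β] φ) := by
  induction β with
  | zero => simpa using h
  | succ β ih =>
    rw [Function.iterate_succ_apply', pow_succ', mul_assoc]
    exact ih.osc hW (by positivity)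

/-! ### Hermite coefficients -/

/-- The `n`-th Hermite coefficient of `φ`. -/
noncomputable def hermiteCoeff (φ : ℝ → ℂ) (n : ℕ) : ℂ := ∫ x, φ x * hermiteC n x

lemma continuous_hermiteC (n : ℕ) : Continuous (hermiteC n) := (contDiff_hermiteC n).continuous

lemma integrable_mul_hermiteC {φ : ℝ → ℂ} (h : Integrable φ) (n : ℕ) :
    Integrable (fun x => φ x * hermiteC n x) :=
  h.mul_bdd (c := n + 2) (continuous_hermiteC n).aestronglyMeasurable
    (Filter.Eventually.of_forall fun x => norm_hermiteC_le n x)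

namespace Majorized

variable {W : ℕ → ℝ} {p : ℕ} {A : ℝ} {φ : ℝ → ℂ}

lemma sq_decay (hW : OscAdmissible W) (hA : 0 ≤ A) (h : Majorized W p A φ) (x : ℝ) :
    (1 + x ^ 2) * ‖φ x‖ ≤ 2 * A * W (p + 2) := by
  have h0 := h.2 0 0 x
  have h2 := h.2 0 2 x
  simp only [iteratedDeriv_zero, pow_zero, one_mul, zero_add, sq_abs] at h0 h2
  rw [add_comm 2 p] at h2
  have h3 := mul_le_mul_of_nonneg_left (hW.le p) hA
  linarith

lemma integrable (hW : OscAdmissible W) (hA : 0 ≤ A) (h : Majorized W p A φ) : Integrable φ :=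
  integrable_of_sq_decay h.1.continuous (h.sq_decay hW hA)

lemma norm_hermiteCoeff_le (hW : OscAdmissible W) (hA : 0 ≤ A) (h : Majorized W p A φ) (n : ℕ) :
    ‖hermiteCoeff φ n‖ ≤ Real.pi * (n + 2) * (2 * A * W (p + 2)) := by
  have hi : Integrable (fun x : ℝ => (1 + x ^ 2)⁻¹ * ((2 * A * W (p + 2)) * (n + 2))) :=
    integrable_inv_one_add_sq.mul_const _
  refine (norm_integral_le_of_norm_le hi (Filter.Eventually.of_forall fun x => ?_)).trans ?_
  · have h1 := h.sq_decay hW hA x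
    have h2 := norm_hermiteC_le n x
    have h3 : ‖φ x‖ ≤ 2 * A * W (p + 2) / (1 + x ^ 2) := by
      rw [le_div_iff₀ (by positivity), mul_comm]
      exact h1
    rw [norm_mul, ← mul_assoc, inv_mul_eq_div]
    exact mul_le_mul h3 h2 (norm_nonneg _) ((norm_nonneg _).trans h3)
  · rw [integral_mul_const, integral_univ_inv_one_add_sq]
    exact le_of_eq (by ring)

lemma hermiteCoeff_id_mul (hW : OscAdmissible W) (hA : 0 ≤ A) (h : Majorized W p A φ) (n : ℕ) :
    hermiteCoeff (fun x : ℝ => (x : ℂ) * φ x) n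
      = ladder n * hermiteCoeff φ (n - 1) + ladder (n + 1) * hermiteCoeff φ (n + 1) := by
  have hi := h.integrable hW hA
  unfold hermiteCoeff
  rw [← integral_const_mul, ← integral_const_mul, ← integral_add
    ((integrable_mul_hermiteC hi _).const_mul _) ((integrable_mul_hermiteC hi _).const_mul _)]
  congr 1
  funext x
  linear_combination φ x * id_mul_hermiteC n x

lemma hermiteCoeff_deriv (hW : OscAdmissible W) (hA : 0 ≤ A) (h : Majorized W p A φ) (n : ℕ) :
    hermiteCoeff (_root_.deriv φ) n
      = ladder (n + 1) * hermiteCoeff φ (n + 1) - ladder n * hermiteCoeff φ (n - 1) := by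
  have hi := h.integrable hW hA
  have i1 := (integrable_mul_hermiteC hi (n - 1)).const_mul (ladder n : ℂ)
  have i2 := (integrable_mul_hermiteC hi (n + 1)).const_mul (ladder (n + 1) : ℂ)
  have hd : ∀ x, HasDerivAt φ (_root_.deriv φ x) x := fun x =>
    (h.1.differentiable (by simp) x).hasDerivAt
  have e : ∀ x, φ x * (ladder n * hermiteC (n - 1) x - ladder (n + 1) * hermiteC (n + 1) x)
      = ladder n * (φ x * hermiteC (n - 1) x) - ladder (n + 1) * (φ x * hermiteC (n + 1) x) :=
    fun x => by ring
  have key := integral_mul_deriv_eq_deriv_mul_of_integrable (u := φ) (v := hermiteC n)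
    (u' := _root_.deriv φ)
    (v' := fun x => ladder n * hermiteC (n - 1) x - ladder (n + 1) * hermiteC (n + 1) x)
    (fun x _ => hd x) (fun x _ => hasDerivAt_hermiteC n x)
    ((i1.sub i2).congr (Filter.Eventually.of_forall fun x => (e x).symm))
    (integrable_mul_hermiteC (h.deriv.integrable hW hA) n) (integrable_mul_hermiteC hi n)
  simp only [e] at key
  rw [integral_sub i1 i2, integral_const_mul, integral_const_mul] at key
  unfold hermiteCoeff
  linear_combination key

/-- The Hermite functions are the eigenfunctions of `N`, tested against `φ`. -/
lemma hermiteCoeff_osc (hW : OscAdmissible W) (hA : 0 ≤ A) (h : Majorized W p A φ) (n : ℕ) :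
    hermiteCoeff (oscFun φ) n = 2 * n * hermiteCoeff φ n := by
  have hx := h.id_mul hW hA
  have hA2 : 0 ≤ 2 * A := by positivity
  have i1 := (integrable_mul_hermiteC (h.deriv.deriv.integrable hW hA) n).neg
  have i2 := integrable_mul_hermiteC ((hx.id_mul hW hA2).integrable hW (by positivity)) n
  have i3 := (integrable_mul_hermiteC (h.integrable hW hA) n).neg
  have e : hermiteCoeff (oscFun φ) n = -hermiteCoeff (_root_.deriv (_root_.deriv φ)) n
      + hermiteCoeff (fun x : ℝ => (x : ℂ) * ((x : ℂ) * φ x)) n - hermiteCoeff φ n := by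
    unfold hermiteCoeff
    have s1 := integral_add i1 i2
    have s2 := integral_add (i1.add i2) i3
    simp only [Pi.add_apply, Pi.neg_apply, integral_neg] at s1 s2
    rw [s1] at s2
    rw [sub_eq_add_neg, ← s2]
    congr 1
    funext x
    rw [oscFun_eq]
    simp only [Pi.add_apply, Pi.neg_apply]
    ring
  rw [e, h.deriv.hermiteCoeff_deriv hW hA, hx.hermiteCoeff_id_mul hW hA2,
    h.hermiteCoeff_deriv hW hA, h.hermiteCoeff_deriv hW hA, h.hermiteCoeff_id_mul hW hA,
    h.hermiteCoeff_id_mul hW hA, Nat.add_sub_cancel]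
  have l1 : (ladder (n + 1) : ℂ) * ladder (n + 1) = (n + 1) / 2 := by
    rw [← Complex.ofReal_mul, ladder_mul_self]
    push_cast
    rfl
  rcases n with _ | n
  · simp only [ladder_zero]
    push_cast at l1 ⊢
    linear_combination 2 * hermiteCoeff φ 0 * l1
  · have l0 : (ladder (n + 1) : ℂ) * ladder (n + 1) = (n + 1) / 2 := by
      rw [← Complex.ofReal_mul, ladder_mul_self]
      push_cast
      rfl
    simp only [Nat.add_sub_cancel]
    push_cast at l1 ⊢
    linear_combination 2 * hermiteCoeff φ (n + 1) * l1 + 2 * hermiteCoeff φ (n + 1) * l0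

lemma hermiteCoeff_osc_iterate (hW : OscAdmissible W) (hA : 0 ≤ A) (h : Majorized W 0 A φ)
    (β n : ℕ) : hermiteCoeff (oscFun^[β] φ) n = (2 * n) ^ β * hermiteCoeff φ n := by
  induction β with
  | zero => simp
  | succ β ih =>
    rw [Function.iterate_succ_apply',
      (h.osc_iterate hW hA β).hermiteCoeff_osc hW (by positivity), ih]
    ring

end Majorized

lemma StepBound.hermiteCoeff_osc_iterate {M : WeightSequence} {m C : ℝ} (hm : 0 < m) {φ : ℝ → ℂ}
    (h : StepBound M m φ C) (β n : ℕ) :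
    hermiteCoeff (oscFun^[β] φ) n = (2 * n) ^ β * hermiteCoeff φ n :=
  (h.majorized hm (1 / m)).hermiteCoeff_osc_iterate
    (oscAdmissible_majorant M (by positivity) le_rfl) (h.nonneg hm) β n

lemma StepBound.integrable {M : WeightSequence} {m C : ℝ} (hm : 0 < m) {φ : ℝ → ℂ}
    (h : StepBound M m φ C) : Integrable φ :=
  (h.majorized hm (1 / m)).integrable
    (oscAdmissible_majorant M (by positivity) le_rfl) (h.nonneg hm)

/-- The Hermite coefficients of an element of `step M m` decay like the inverse of the symbol. -/
lemma exists_norm_hermiteCoeff_mul_symbol_le {M : WeightSequence} {A H L m ν : ℝ}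
    (hM : M.GrowthAt L) (hH : M.StableWith A H) (hL : 0 < L) (hm : 0 < m) (hmL : L * m ≤ 1)
    (hν : 0 < ν) (hνm : 5 * H * ν ≤ m) :
    ∃ K : ℝ, 0 < K ∧ ∀ (φ : ℝ → ℂ) (C : ℝ), StepBound M m φ C →
      ∀ n : ℕ, ‖hermiteCoeff φ n‖ * symbol M ν n ≤ K * (n + 2) * C := by
  obtain ⟨hA, hH0, h⟩ := id hH
  obtain ⟨G, hG, hmaj⟩ := exists_majorant_le hL hM
  have hM2 := M.pos 2
  have hLm : L ≤ 1 / m := by rwa [le_div_iff₀ hm]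
  have hW := oscAdmissible_majorant M hL hLm
  set K0 : ℝ := 2 * Real.pi * G * A * M 2 * (4 * H ^ 2 / m ^ 2) with hK0
  -- the ratio of the geometric series that bounds the terms of the symbol: `12` is the `6` lost with
  -- each application of `N` times `2 ^ 2` from the majorant, divided by the `2` in `N h n = 2 n h n`
  have hr : 12 * H ^ 2 * ν ^ 2 / m ^ 2 ≤ 1 / 2 := by
    rw [div_le_div_iff₀ (by positivity) (by norm_num)]
    have := pow_le_pow_left₀ (by positivity) hνm 2
    nlinarith [sq_nonneg (H * ν)]
  refine ⟨2 * K0, by positivity, fun φ C hφ n => ?_⟩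
  have hC := hφ.nonneg hm
  have hφ' := hφ.majorized hm L
  have key : ∀ β, ‖hermiteCoeff φ n‖ * symbolTerm M ν n β
      ≤ K0 * (n + 2) * C * (1 / 2) ^ β := by
    intro β
    have hβ := M.pos (2 * β)
    have h1 := (hφ'.osc_iterate hW hC β).norm_hermiteCoeff_le hW (by positivity) n
    rw [hφ'.hermiteCoeff_osc_iterate hW hC, norm_mul, norm_pow, norm_mul, Complex.norm_natCast,
      Complex.norm_ofNat, mul_pow] at h1
    have h2 := hmaj (2 * β + 2)
    have h3 := h (2 * β) 2
    have h4 : (1 / m) ^ (2 * β + 2) * majorant M L (2 * β + 2)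
        ≤ (1 / m) ^ (2 * β + 2) * (G * 2 ^ (2 * β + 2)
          * (A * H ^ (2 * β + 2) * (M (2 * β) * M 2))) := by
      gcongr
      exact h2.trans (by gcongr)
    have h5 : (n : ℝ) ^ β * ‖hermiteCoeff φ n‖ ≤ Real.pi * (n + 2) * (2 * (3 ^ β * C) *
        ((1 / m) ^ (2 * β + 2) * (G * 2 ^ (2 * β + 2)
          * (A * H ^ (2 * β + 2) * (M (2 * β) * M 2))))) := by
      refine le_of_mul_le_mul_left ?_ (by positivity : (0 : ℝ) < 2 ^ β)
      calc (2 : ℝ) ^ β * ((n : ℝ) ^ β * ‖hermiteCoeff φ n‖)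
          = 2 ^ β * (n : ℝ) ^ β * ‖hermiteCoeff φ n‖ := by ring
        _ ≤ _ := h1
        _ ≤ Real.pi * (n + 2) * (2 * (6 ^ β * C) * ((1 / m) ^ (2 * β + 2) * (G * 2 ^ (2 * β + 2)
          * (A * H ^ (2 * β + 2) * (M (2 * β) * M 2))))) := by gcongr
        _ = _ := by
          rw [show (6 : ℝ) = 2 * 3 by norm_num, mul_pow 2 3]
          ring
    calc ‖hermiteCoeff φ n‖ * symbolTerm M ν n β
        = ν ^ (2 * β) / M (2 * β) * ((n : ℝ) ^ β * ‖hermiteCoeff φ n‖) := by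
          unfold symbolTerm; ring
      _ ≤ ν ^ (2 * β) / M (2 * β) * (Real.pi * (n + 2) * (2 * (3 ^ β * C) *
        ((1 / m) ^ (2 * β + 2) * (G * 2 ^ (2 * β + 2)
          * (A * H ^ (2 * β + 2) * (M (2 * β) * M 2)))))) := by gcongr
      _ = K0 * (n + 2) * C * (12 * H ^ 2 * ν ^ 2 / m ^ 2) ^ β := by
          have e : (12 * H ^ 2 * ν ^ 2 / m ^ 2) ^ β
              = 3 ^ β * 2 ^ (2 * β) * H ^ (2 * β) * ν ^ (2 * β) / m ^ (2 * β) := by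
            rw [div_pow, mul_pow, mul_pow, ← pow_mul, ← pow_mul, ← pow_mul, pow_mul 2 2 β, ← mul_pow]
            norm_num
          rw [e, hK0, div_pow, one_pow, pow_add m, pow_add H, pow_add 2]
          field_simp
          ring
      _ ≤ _ := by gcongr
  have hs := (hasSum_geometric_two.mul_left (K0 * (n + 2) * C))
  have hsum := ((summable_symbolTerm hM ν n).mul_left ‖hermiteCoeff φ n‖)
  calc ‖hermiteCoeff φ n‖ * symbol M ν n = ∑' β, ‖hermiteCoeff φ n‖ * symbolTerm M ν n β := by
        rw [symbol, tsum_mul_left]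
    _ ≤ ∑' β, K0 * (n + 2) * C * (1 / 2) ^ β := hsum.tsum_le_tsum key hs.summable
    _ = 2 * K0 * (n + 2) * C := by rw [hs.tsum_eq]; ring


/-! ### Hermite expansion of test functions -/

lemma StepBound.const_smul {M : WeightSequence} {m C : ℝ} {φ : ℝ → ℂ} (h : StepBound M m φ C)
    (c : ℂ) : StepBound M m (c • φ) (‖c‖ * C) :=
  ⟨contDiff_const.smul h.1, fun t => by
    rw [stepTerm_smul]
    exact mul_le_mul_of_nonneg_left (h.2 t) (norm_nonneg c)⟩

lemma StepBound.norm_le {M : WeightSequence} {m C : ℝ} {φ : ℝ → ℂ} (h : StepBound M m φ C)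
    (x : ℝ) : ‖φ x‖ ≤ C := by
  simpa [stepTerm, M.zero_eq_one] using h.2 (0, 0, x)

lemma StepBound.tsum {M : WeightSequence} {m : ℝ} (hm : 0 < m) {ψ : ℕ → ℝ → ℂ} {u : ℕ → ℝ}
    (h : ∀ i, StepBound M m (ψ i) (u i)) (hu : Summable u) :
    StepBound M m (fun x => ∑' i, ψ i x) (∑' i, u i) := by
  have hv : ∀ k : ℕ, (k : ℕ∞) ≤ ⊤ → Summable fun i => M k / m ^ k * u i :=
    fun k _ => hu.mul_left _
  have hb : ∀ (k i : ℕ) (x : ℝ), (k : ℕ∞) ≤ ⊤ →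
      ‖iteratedFDeriv ℝ k (ψ i) x‖ ≤ M k / m ^ k * u i := by
    intro k i x _
    have h1 := (h i).2 (k, 0, x)
    have hk := M.pos k
    simp only [stepTerm, M.zero_eq_one, mul_one, add_zero, Nat.cast_zero, zero_div,
      Real.rpow_zero, one_mul] at h1
    rw [norm_iteratedFDeriv_eq_norm_iteratedDeriv]
    rw [div_mul_eq_mul_div, div_le_iff₀ hk] at h1
    rw [div_mul_eq_mul_div, le_div_iff₀ (by positivity)]
    linarith
  refine ⟨contDiff_tsum (N := ⊤) (fun i => (h i).1) hv hb, ?_⟩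
  rintro ⟨a, b, x⟩
  have ha := M.pos a
  have hb' := M.pos b
  have hs : Summable fun i => ‖iteratedDeriv a (ψ i) x‖ :=
    Summable.of_nonneg_of_le (fun i => norm_nonneg _) (fun i => by
      rw [← norm_iteratedFDeriv_eq_norm_iteratedDeriv]
      exact hb a i x le_top) (hv a le_top)
  have hn : ‖iteratedDeriv a (fun x => ∑' i, ψ i x) x‖ ≤ ∑' i, ‖iteratedDeriv a (ψ i) x‖ := by
    rw [← norm_iteratedFDeriv_eq_norm_iteratedDeriv,
      iteratedFDeriv_tsum_apply (N := ⊤) (fun i => (h i).1) hv hb le_top]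
    simp only [← norm_iteratedFDeriv_eq_norm_iteratedDeriv] at hs ⊢
    exact norm_tsum_le_tsum_norm hs
  unfold stepTerm
  simp only []
  set w := m ^ (a + b) / (M a * M b) * (1 + x ^ 2) ^ ((b : ℝ) / 2) with hw
  have hw0 : 0 ≤ w := by positivity
  calc m ^ (a + b) / (M a * M b) * ((1 + x ^ 2) ^ ((b : ℝ) / 2)
        * ‖iteratedDeriv a (fun x => ∑' i, ψ i x) x‖)
      = w * ‖iteratedDeriv a (fun x => ∑' i, ψ i x) x‖ := by rw [hw]; ring
    _ ≤ w * ∑' i, ‖iteratedDeriv a (ψ i) x‖ := by gcongr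
    _ = ∑' i, w * ‖iteratedDeriv a (ψ i) x‖ := by rw [tsum_mul_left]
    _ ≤ ∑' i, u i := by
        refine (hs.mul_left w).tsum_le_tsum (fun i => ?_) hu
        refine le_trans (le_of_eq ?_) ((h i).2 (a, b, x))
        rw [hw, stepTerm]
        ring

lemma hermiteCoeff_hermiteC (i n : ℕ) : hermiteCoeff (hermiteC i) n = if i = n then 1 else 0 := by
  have h := integral_hermiteFun_mul i n
  unfold hermiteCoeff hermiteC
  simp only [← Complex.ofReal_mul]
  rw [integral_complex_ofReal, h]
  split_ifs <;> simp

/-- A series of Hermite functions may be integrated term by term. -/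
lemma hasSum_mul_hermiteCoeff {c : ℕ → ℂ} {v : ℕ → ℝ} (hv : ∀ n x, ‖hermiteC n x‖ ≤ v n)
    (hs : Summable fun n => ‖c n‖ * v n) {ψ : ℝ → ℂ} (hψ : Integrable ψ) :
    HasSum (fun n => c n * hermiteCoeff ψ n) (∫ x, (∑' n, c n * hermiteC n x) * ψ x) := by
  have hint : ∀ n, Integrable (fun x => c n * (ψ x * hermiteC n x)) :=
    fun n => (integrable_mul_hermiteC hψ n).const_mul _
  have key := hasSum_integral_of_summable_integral_norm (μ := volume)
    (F := fun n x => c n * (ψ x * hermiteC n x)) hint (by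
      refine Summable.of_nonneg_of_le (fun n => integral_nonneg fun x => norm_nonneg _)
        (fun n => ?_) (hs.mul_right (∫ x, ‖ψ x‖))
      rw [← integral_const_mul]
      refine integral_mono (hint n).norm (hψ.norm.const_mul _) fun x => ?_
      simp only [norm_mul]
      calc ‖c n‖ * (‖ψ x‖ * ‖hermiteC n x‖) ≤ ‖c n‖ * (‖ψ x‖ * v n) := by gcongr; exact hv n x
        _ = _ := by ring)
  simp only [integral_const_mul] at key
  have e : ∀ x, (∑' n, c n * hermiteC n x) * ψ x = ∑' n, c n * (ψ x * hermiteC n x) := by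
    intro x
    rw [← tsum_mul_right]
    congr 1
    funext n
    ring
  simp only [e]
  exact key

/-- A test function is the sum of its Hermite series, with an estimate of the remainders. -/
lemma stepBound_sub_sum_hermiteC {M : WeightSequence} {m m' C : ℝ} (hm : 0 < m) (hm' : 0 < m')
    {φ : ℝ → ℂ} (hφ : StepBound M m φ C) {v : ℕ → ℝ}
    (hv : ∀ n, StepBound M m' (hermiteC n) (v n))
    (hs : Summable fun n => ‖hermiteCoeff φ n‖ * v n) (k : ℕ) :
    StepBound M m' (φ - ∑ i ∈ Finset.range k, hermiteCoeff φ i • hermiteC i)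
      (∑' i, ‖hermiteCoeff φ (i + k)‖ * v (i + k)) := by
  have hb : ∀ n, StepBound M m' (hermiteCoeff φ n • hermiteC n) (‖hermiteCoeff φ n‖ * v n) :=
    fun n => (hv n).const_smul _
  have hsum := StepBound.tsum hm' hb hs
  have hps : ∀ x, Summable fun n => hermiteCoeff φ n * hermiteC n x := fun x =>
    Summable.of_norm_bounded hs fun n => (hb n).norm_le x
  -- the sum of the series has the same Hermite coefficients as `φ`
  have heq : φ - (fun x => ∑' i, (hermiteCoeff φ i • hermiteC i) x) = 0 := by
    refine eq_zero_of_integral_mul_hermiteFun (hφ.1.sub hsum.1).continuous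
      (fun x => (norm_sub_le _ _).trans (add_le_add (hφ.norm_le x) (hsum.norm_le x))) fun n => ?_
    have hn : Integrable (hermiteC n) := (integrable_hermiteFun n).ofReal
    have h1 := hasSum_mul_hermiteCoeff (fun n x => (hv n).norm_le x) hs hn
    have h2 : HasSum (fun i => hermiteCoeff φ i * hermiteCoeff (hermiteC n) i)
        (hermiteCoeff φ n) := by
      simp only [hermiteCoeff_hermiteC]
      convert hasSum_ite_eq n (hermiteCoeff φ n) using 2 with i
      rcases eq_or_ne n i with rfl | h
      · simp
      · simp [h, h.symm]
    have h3 := h1.unique h2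
    have i1 := integrable_mul_hermiteC (hφ.integrable hm) n
    have i2 := integrable_mul_hermiteC (hsum.integrable hm') n
    change ∫ x, (φ x - ∑' i, hermiteCoeff φ i * hermiteC i x) * hermiteC n x = 0
    simp only [Pi.smul_apply, smul_eq_mul] at i2
    simp only [sub_mul]
    rw [integral_sub i1 i2, h3]
    exact sub_self _
  have htail := StepBound.tsum hm' (fun i => hb (i + k)) ((summable_nat_add_iff k).2 hs)
  convert htail using 1
  funext x
  have hx : φ x = ∑' i, hermiteCoeff φ i * hermiteC i x := by
    have := congrFun heq x
    simpa [sub_eq_zero] using this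
  have := (hps x).sum_add_tsum_nat_add k
  simp only [Pi.sub_apply, Finset.sum_apply, Pi.smul_apply, smul_eq_mul]
  rw [hx, ← this]
  ring

/-! ### Functionals on spaces of test functions -/

/-- The functional `T` on `E`, a space of functions through `J`, is bounded with respect to the
norm of `step M m`. -/
def BoundedOn {E : Type*} [AddCommGroup E] [Module ℂ E] (M : WeightSequence) (J : E →ₗ[ℂ] ℝ → ℂ)
    (m : ℝ) (T : E →ₗ[ℂ] ℂ) : Prop :=
  ∃ C : ℝ, 0 < C ∧ ∀ (φ : E) (B : ℝ), StepBound M m (J φ) B → ‖T φ‖ ≤ C * B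

section Functionals

variable {E : Type*} [AddCommGroup E] [Module ℂ E] {M : WeightSequence} {J : E →ₗ[ℂ] ℝ → ℂ}
  {e : ℕ → E}

lemma summable_add_two_sq_inv : Summable fun n : ℕ => (((n : ℝ) + 2) ^ 2)⁻¹ := by
  have h := (summable_nat_add_iff 2).2 (Real.summable_nat_pow_inv (p := 2).2 (by norm_num))
  simpa using h

lemma BoundedOn.hasSum_hermiteCoeff {T : E →ₗ[ℂ] ℂ} {m m' C : ℝ} (hT : BoundedOn M J m' T)
    (he : ∀ n, J (e n) = hermiteC n) (hm : 0 < m) (hm' : 0 < m') {φ : E}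
    (hφ : StepBound M m (J φ) C) {v : ℕ → ℝ} (hv : ∀ n, StepBound M m' (hermiteC n) (v n))
    (hs : Summable fun n => ‖hermiteCoeff (J φ) n‖ * v n) :
    HasSum (fun n => hermiteCoeff (J φ) n * T (e n)) (T φ) := by
  obtain ⟨K, hK, hT⟩ := hT
  have hsum : Summable fun n => hermiteCoeff (J φ) n * T (e n) := by
    refine Summable.of_norm_bounded (hs.mul_left K) fun n => ?_
    rw [norm_mul]
    have := hT (e n) (v n) (by rw [he]; exact hv n)
    calc ‖hermiteCoeff (J φ) n‖ * ‖T (e n)‖ ≤ ‖hermiteCoeff (J φ) n‖ * (K * v n) := by gcongr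
      _ = _ := by ring
  rw [hsum.hasSum_iff_tendsto_nat, tendsto_iff_norm_sub_tendsto_zero]
  have htail : Filter.Tendsto
      (fun k => K * ∑' i, ‖hermiteCoeff (J φ) (i + k)‖ * v (i + k)) Filter.atTop (nhds 0) := by
    simpa using (tendsto_sum_nat_add fun n => ‖hermiteCoeff (J φ) n‖ * v n).const_mul K
  refine squeeze_zero (fun _ => norm_nonneg _) (fun k => ?_) htail
  have h1 := hT (φ - ∑ i ∈ Finset.range k, hermiteCoeff (J φ) i • e i) _ (by
    simp only [map_sub, map_sum, map_smul, he]
    exact stepBound_sub_sum_hermiteC hm hm' hφ hv hs k)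
  rw [norm_sub_rev]
  simpa only [map_sub, map_sum, map_smul, smul_eq_mul] using h1

lemma BoundedOn.exists_norm_le_symbol {T : E →ₗ[ℂ] ℂ} {A H L m μ : ℝ} (hT : BoundedOn M J m T)
    (he : ∀ n, J (e n) = hermiteC n) (hM : M.GrowthAt L)
    (hH : M.StableWith A H) (hL : 0 < L) (hm : 0 < m) (hmL : 9 * H * m * L ≤ 1)
    (hμ : H * (9 * H * m) ≤ μ) :
    ∃ K : ℝ, 0 < K ∧ ∀ n : ℕ, ‖T (e n)‖ ≤ K * symbol M μ n / (n + 2) ^ 3 := by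
  obtain ⟨K, hK, h⟩ := exists_stepBound_hermiteC hM hH hL hm hmL hμ 3
  obtain ⟨C, hC, hT⟩ := hT
  refine ⟨C * K, by positivity, fun n => ?_⟩
  have := hT (e n) _ (by rw [he]; exact h n)
  rwa [← mul_div_assoc, ← mul_assoc] at this

/-- The Hermite expansion of `T φ` when the decay of the Hermite coefficients of `φ`, governed
by `m₁`, outweighs the growth of those of `T`, governed by `m`. -/
lemma BoundedOn.exists_hermite_pairing {T : E →ₗ[ℂ] ℂ} {A H L L₁ m m₁ ν : ℝ}
    (hT : BoundedOn M J m T) (he : ∀ n, J (e n) = hermiteC n) (hH : M.StableWith A H)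
    (hM : M.GrowthAt L) (hL : 0 < L) (hm : 0 < m) (hmL : 9 * H * m * L ≤ 1)
    (hν : 0 < ν) (hmν : H * (9 * H * m) ≤ ν)
    (hM₁ : M.GrowthAt L₁) (hL₁ : 0 < L₁) (hm₁ : 0 < m₁) (hmL₁ : L₁ * m₁ ≤ 1)
    (hνm₁ : 5 * H * ν ≤ m₁) :
    ∃ K : ℝ, 0 < K ∧ ∀ (φ : E) (C : ℝ), StepBound M m₁ (J φ) C →
      HasSum (fun n => hermiteCoeff (J φ) n * T (e n)) (T φ) ∧
      ∀ n : ℕ, ‖T (e n)‖ * ‖hermiteCoeff (J φ) n‖ * (n + 2) ^ 2 ≤ K * C := by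
  obtain ⟨K₁, hK₁, h₁⟩ := exists_norm_hermiteCoeff_mul_symbol_le hM₁ hH hL₁ hm₁ hmL₁ hν hνm₁
  obtain ⟨K₂, hK₂, h₂⟩ := exists_stepBound_hermiteC hM hH hL hm hmL hmν 3
  obtain ⟨K₃, hK₃, h₃⟩ := hT.exists_norm_le_symbol he hM hH hL hm hmL hmν
  have hkey : ∀ (φ : E) (C : ℝ), StepBound M m₁ (J φ) C → ∀ n (K : ℝ), 0 < K →
      ‖hermiteCoeff (J φ) n‖ * (K * symbol M ν n / ((n : ℝ) + 2) ^ 3)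
        ≤ K * K₁ * C * (((n : ℝ) + 2) ^ 2)⁻¹ := by
    intro φ C hφ n K hK
    have h := h₁ (J φ) C hφ n
    rw [← div_eq_mul_inv, ← mul_div_assoc, div_le_div_iff₀ (by positivity) (by positivity)]
    calc ‖hermiteCoeff (J φ) n‖ * (K * symbol M ν n) * ((n : ℝ) + 2) ^ 2
        = K * ((n : ℝ) + 2) ^ 2 * (‖hermiteCoeff (J φ) n‖ * symbol M ν n) := by ring
      _ ≤ K * ((n : ℝ) + 2) ^ 2 * (K₁ * (n + 2) * C) := by gcongr
      _ = _ := by ring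
  refine ⟨K₃ * K₁, by positivity, fun φ C hφ => ⟨?_, fun n => ?_⟩⟩
  · refine hT.hasSum_hermiteCoeff he hm₁ hm hφ h₂ ?_
    have hC := hφ.nonneg hm₁
    refine Summable.of_nonneg_of_le (fun n => ?_) (fun n => hkey φ C hφ n K₂ hK₂)
      (summable_add_two_sq_inv.mul_left _)
    have := (h₂ n).nonneg hm
    positivity
  · have h := hkey φ C hφ n K₃ hK₃
    have h3 := h₃ n
    calc ‖T (e n)‖ * ‖hermiteCoeff (J φ) n‖ * ((n : ℝ) + 2) ^ 2
        ≤ (K₃ * symbol M ν n / (n + 2) ^ 3) * ‖hermiteCoeff (J φ) n‖ * ((n : ℝ) + 2) ^ 2 := by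
          gcongr
      _ = ‖hermiteCoeff (J φ) n‖ * (K₃ * symbol M ν n / (n + 2) ^ 3) * ((n : ℝ) + 2) ^ 2 := by ring
      _ ≤ K₃ * K₁ * C * (((n : ℝ) + 2) ^ 2)⁻¹ * ((n : ℝ) + 2) ^ 2 := by gcongr
      _ = _ := by field_simp

end Functionals


/-! ### The series in the strong dual -/

/-- Convergence in the strong dual from a dominated expansion. The factors `s β n / S n` sum up
to `1` over `β`, and the terms `a n * b n φ` have a summable bound, uniform over bounded sets
of `φ`. -/
lemma hasSum_strongDual_of_dominated {E : Type*} [AddCommGroup E] [Module ℂ E]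
    [TopologicalSpace E] {T : StrongDual ℂ E} {U : ℕ → StrongDual ℂ E} {a : ℕ → ℂ} {b : E → ℕ → ℂ}
    {s : ℕ → ℕ → ℝ} {S u : ℕ → ℝ} (hs : ∀ n β, 0 ≤ s n β) (hS : ∀ n, HasSum (s n) (S n))
    (hS0 : ∀ n, 0 < S n) (hT : ∀ φ, HasSum (fun n => a n * b φ n) (T φ))
    (hU : ∀ φ β, HasSum (fun n => ((s n β / S n : ℝ) : ℂ) * (a n * b φ n)) (U β φ))
    (hu : Summable u) (hu0 : ∀ n, 0 ≤ u n)
    (hB : ∀ B : Set E, Bornology.IsVonNBounded ℂ B →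
      ∃ K : ℝ, ∀ φ ∈ B, ∀ n, ‖a n * b φ n‖ ≤ K * u n) : HasSum U T := by
  -- the proportion of `S n` missing from the partial sum over `F`
  set ρ : Finset ℕ → ℕ → ℝ := fun F n => 1 - (∑ β ∈ F, s n β) / S n with hρ
  have hρ0 : ∀ F n, 0 ≤ ρ F n := fun F n => by
    rw [hρ, sub_nonneg, div_le_one (hS0 n)]
    exact sum_le_hasSum F (fun β _ => hs n β) (hS n)
  have hρ1 : ∀ F n, ρ F n ≤ 1 := fun F n => by
    have : 0 ≤ (∑ β ∈ F, s n β) / S n :=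
      div_nonneg (Finset.sum_nonneg fun β _ => hs n β) (hS0 n).le
    simp only [hρ]
    linarith
  have hlim : Filter.Tendsto (fun F => ∑' n, u n * ρ F n) Filter.atTop (nhds 0) := by
    have := tendsto_tsum_of_dominated_convergence (𝓕 := Filter.atTop)
      (f := fun F n => u n * ρ F n) (g := fun _ : ℕ => (0 : ℝ)) (bound := u) hu
      (fun n => by
        have h1 : Filter.Tendsto (fun F : Finset ℕ => ∑ β ∈ F, s n β) Filter.atTop
          (nhds (S n)) := hS n
        have h2 := ((h1.div_const (S n)).const_sub 1).const_mul (u n)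
        rwa [div_self (hS0 n).ne', sub_self, mul_zero] at h2)
      (Filter.Eventually.of_forall fun F n => by
        rw [norm_mul, Real.norm_of_nonneg (hu0 n), Real.norm_of_nonneg (hρ0 F n)]
        exact mul_le_of_le_one_right (hu0 n) (hρ1 F n))
    simpa using this
  have hsum : ∀ F, Summable fun n => u n * ρ F n := fun F =>
    Summable.of_nonneg_of_le (fun n => mul_nonneg (hu0 n) (hρ0 F n))
      (fun n => mul_le_of_le_one_right (hu0 n) (hρ1 F n)) hu
  change Filter.Tendsto (fun F : Finset ℕ => ∑ β ∈ F, U β) Filter.atTop (nhds T)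
  rw [← tendsto_sub_nhds_zero_iff, (ContinuousLinearMap.hasBasis_nhds_zero_of_basis
    Metric.nhds_basis_ball).tendsto_right_iff]
  rintro ⟨B, ε⟩ ⟨hBb, hε⟩
  obtain ⟨K, hK⟩ := hB B hBb
  have hlimK := hlim.const_mul K
  rw [mul_zero] at hlimK
  filter_upwards [hlimK.eventually (gt_mem_nhds hε)] with F hF φ hφ
  rw [mem_ball_zero_iff]
  refine lt_of_le_of_lt ?_ hF
  have h1 : HasSum (fun n => -((ρ F n : ℝ) : ℂ) * (a n * b φ n)) ((∑ β ∈ F, U β - T) φ) := by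
    have h2 := (hasSum_sum fun β (_ : β ∈ F) => hU φ β).sub (hT φ)
    have e : (∑ β ∈ F, U β - T) φ = ∑ β ∈ F, U β φ - T φ := by simp
    rw [e]
    refine Eq.mpr (congrArg (fun g : ℕ → ℂ => HasSum g _) (funext fun n => ?_)) h2
    rw [← Finset.sum_mul]
    simp only [hρ]
    push_cast
    rw [Finset.sum_div]
    ring
  rw [← h1.tsum_eq, ← tsum_mul_left]
  refine tsum_of_norm_bounded ((hsum F).mul_left K).hasSum fun n => ?_
  rw [norm_mul, norm_neg, Complex.norm_real, Real.norm_of_nonneg (hρ0 F n)]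
  calc ρ F n * ‖a n * b φ n‖ ≤ ρ F n * (K * u n) :=
        mul_le_mul_of_nonneg_left (hK φ hφ n) (hρ0 F n)
    _ = _ := by ring

/-- The representation theorem for a space `E` of test functions, included in the functions
through `J`, on which `osc` acts as `N` and `D` is its transpose. The function `f` is the
Hermite series whose coefficients are those of `T` divided by the symbol. -/
lemma exists_hasSum_osc {E : Type*} [AddCommGroup E] [Module ℂ E] [TopologicalSpace E]
    {M : WeightSequence} {J : E →ₗ[ℂ] ℝ → ℂ} {e : ℕ → E} {osc : E → E}
    {ofFun : (ℝ →ᵇ ℂ) → StrongDual ℂ E} {D : Module.End ℂ (StrongDual ℂ E)}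
    (hJ : ∀ φ, ∃ m : ℝ, 0 < m ∧ ∃ C, StepBound M m (J φ) C)
    (hosc : ∀ φ, J (osc φ) = oscFun (J φ)) (hD : ∀ S φ, D S φ = S (osc φ))
    (hofFun : ∀ f φ, ofFun f φ = ∫ x, f x * J φ x) {L μ : ℝ} (hM : M.GrowthAt L)
    {T : StrongDual ℂ E} {K : ℝ}
    (hK : ∀ n, ‖T (e n)‖ ≤ K * symbol M μ n / (n + 2) ^ 3)
    (hT : ∀ φ, HasSum (fun n => hermiteCoeff (J φ) n * T (e n)) (T φ))
    (hB : ∀ B : Set E, Bornology.IsVonNBounded ℂ B →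
      ∃ K : ℝ, ∀ φ ∈ B, ∀ n : ℕ, ‖T (e n)‖ * ‖hermiteCoeff (J φ) n‖ * (n + 2) ^ 2 ≤ K) :
    ∃ f : ℝ →ᵇ ℂ, HasSum (fun β : ℕ => ((μ ^ (2 * β) / M (2 * β) * (1 / 2 ^ β) : ℝ) : ℂ) •
      (D ^ β) (ofFun f)) T := by
  have hP : ∀ n, 0 < symbol M μ n := fun n => one_pos.trans_le (one_le_symbol hM μ n)
  set c : ℕ → ℂ := fun n => T (e n) / (symbol M μ n : ℂ) with hc
  have hcs : Summable fun n => ‖c n‖ * ((n : ℝ) + 2) := by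
    refine Summable.of_nonneg_of_le (fun n => by positivity) (fun n => ?_)
      (summable_add_two_sq_inv.mul_left K)
    have h := hK n
    have hp := hP n
    rw [hc, norm_div, Complex.norm_real, Real.norm_of_nonneg hp.le, ← div_eq_mul_inv,
      div_mul_eq_mul_div, div_le_div_iff₀ hp (by positivity)]
    rw [le_div_iff₀ (by positivity)] at h
    linarith
  have hcb : ∀ n x, ‖c n * hermiteC n x‖ ≤ ‖c n‖ * ((n : ℝ) + 2) := fun n x => by
    rw [norm_mul]
    gcongr
    exact norm_hermiteC_le n x
  let f : ℝ →ᵇ ℂ := BoundedContinuousFunction.ofNormedAddCommGroup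
    (fun x => ∑' n, c n * hermiteC n x)
    (continuous_tsum (fun n => continuous_const.mul (continuous_hermiteC n)) hcs hcb)
    (∑' n, ‖c n‖ * ((n : ℝ) + 2)) (fun x => tsum_of_norm_bounded hcs.hasSum fun n => hcb n x)
  have hDβ : ∀ (β : ℕ) (S : StrongDual ℂ E) (φ : E), (D ^ β) S φ = S (osc^[β] φ) := by
    intro β
    induction β with
    | zero => intro S φ; simp
    | succ β ih =>
      intro S φ
      rw [pow_succ', Module.End.mul_apply, hD, ih, Function.iterate_succ_apply]
  have hoscβ : ∀ (β : ℕ) (φ : E), J (osc^[β] φ) = oscFun^[β] (J φ) := by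
    intro β
    induction β with
    | zero => intro φ; rfl
    | succ β ih => intro φ; rw [Function.iterate_succ_apply', hosc, ih,
        Function.iterate_succ_apply']
  refine ⟨f, hasSum_strongDual_of_dominated (a := fun n => T (e n))
    (b := fun φ n => hermiteCoeff (J φ) n) (s := symbolTerm M μ) (S := symbol M μ)
    (symbolTerm_nonneg M μ) (fun n => (summable_symbolTerm hM μ n).hasSum) hP
    (fun φ => by simpa only [mul_comm] using hT φ) (fun φ β => ?_)
    summable_add_two_sq_inv (fun n => by positivity) fun B hBb => ?_⟩
  · obtain ⟨m, hm, C, hφ⟩ := hJ φ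
    obtain ⟨m', hm', C', hφ'⟩ := hJ (osc^[β] φ)
    have h1 := hasSum_mul_hermiteCoeff norm_hermiteC_le hcs (hφ'.integrable hm')
    have h2 : ofFun f (osc^[β] φ) = ∫ x, (∑' n, c n * hermiteC n x) * J (osc^[β] φ) x :=
      hofFun f _
    rw [← h2] at h1
    have h3 := h1.mul_left ((μ ^ (2 * β) / M (2 * β) * (1 / 2 ^ β) : ℝ) : ℂ)
    have e2 : ((((μ ^ (2 * β) / M (2 * β) * (1 / 2 ^ β) : ℝ) : ℂ) • (D ^ β) (ofFun f)) φ)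
        = ((μ ^ (2 * β) / M (2 * β) * (1 / 2 ^ β) : ℝ) : ℂ) * ofFun f (osc^[β] φ) := by
      rw [← hDβ]
      rfl
    rw [e2]
    refine Eq.mpr (congrArg (fun g : ℕ → ℂ => HasSum g _) (funext fun n => ?_)) h3
    rw [hoscβ, hφ.hermiteCoeff_osc_iterate hm, hc, symbolTerm, mul_pow]
    have hp : (symbol M μ n : ℂ) ≠ 0 := by exact_mod_cast (hP n).ne'
    have hq : (M (2 * β) : ℂ) ≠ 0 := by exact_mod_cast (M.pos _).ne'
    push_cast
    field_simp
  · obtain ⟨K', hK'⟩ := hB B hBb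
    refine ⟨K', fun φ hφ n => ?_⟩
    rw [norm_mul, ← div_eq_mul_inv, le_div_iff₀ (by positivity)]
    exact hK' φ hφ n

/-! ### Roumieu spaces -/

/-- The inclusion of the Roumieu space in the space of all functions. -/
def roumieuIncl (M : WeightSequence) : RoumieuSpace M →ₗ[ℂ] ℝ → ℂ where
  toFun := RoumieuSpace.toFun
  map_add' _ _ := rfl
  map_smul' _ _ := rfl

lemma roumieu_exists_stepBound {M : WeightSequence} (φ : RoumieuSpace M) {R : ℝ} (hR : 0 < R) :
    ∃ m : ℝ, 0 < m ∧ m ≤ R ∧ ∃ C, StepBound M m (roumieuIncl M φ) C := by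
  obtain ⟨m, hm⟩ := φ.exists_mem_step
  have hm0 : (0 : ℝ) < m := m.2
  exact ⟨min m R, lt_min hm0 hR, min_le_right _ _, _,
    (StepBound.of_mem hm).mono (lt_min hm0 hR) (min_le_left _ _)⟩

lemma roumieu_boundedOn {M : WeightSequence} (T : StrongDual ℂ (RoumieuSpace M)) {m : ℝ}
    (hm : 0 < m) : BoundedOn M (roumieuIncl M) m T.toLinearMap := by
  obtain ⟨s, C, -, hC⟩ := Seminorm.bound_of_continuous (roumieu_withSeminorms M)
    ((normSeminorm ℂ ℂ).comp T.toLinearMap) (continuous_norm.comp T.continuous)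
  have hs : ∃ K : ℝ, 0 ≤ K ∧ ∀ (φ : RoumieuSpace M) (B : ℝ),
      StepBound M m (roumieuIncl M φ) B → s.sup (roumieuSeminorms M) φ ≤ K * B := by
    clear hC
    induction s using Finset.cons_induction with
    | empty => exact ⟨0, le_rfl, fun φ B _ => by simp⟩
    | cons p s hp ih =>
      obtain ⟨K, hK, ih⟩ := ih
      obtain ⟨K', hK'⟩ := p.2 ⟨m, hm⟩
      refine ⟨max K |K'|, le_max_of_le_left hK, fun φ B hφ => ?_⟩
      have hB := hφ.nonneg hm
      rw [Finset.sup_cons]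
      refine sup_le ?_ ?_
      · refine (hK' φ (StepBound.mem (m := ⟨m, hm⟩) hφ)).trans ?_
        have h1 := StepBound.le (m := ⟨m, hm⟩) hφ
        exact mul_le_mul ((le_abs_self K').trans (le_max_right _ _)) h1 (apply_nonneg _ _)
          (le_max_of_le_left hK)
      · exact (ih φ B hφ).trans (by gcongr; exact le_max_left _ _)
  obtain ⟨K, hK, hs⟩ := hs
  refine ⟨C * K + 1, by positivity, fun φ B hφ => ?_⟩
  have hB := hφ.nonneg hm
  calc ‖T φ‖ ≤ C * s.sup (roumieuSeminorms M) φ := hC φ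
    _ ≤ C * (K * B) := by gcongr; exact hs φ B hφ
    _ ≤ _ := by linarith

/-- The seminorm `⨆ n, w n * |b n|`, with `b n` the Hermite coefficients, is continuous on the
Roumieu space as soon as it is finite with continuous restrictions to the `step M m`; hence it
is bounded on bounded sets. -/
lemma roumieu_bounded_hermiteCoeff {M : WeightSequence} {w : ℕ → ℝ} (hw : ∀ n, 0 ≤ w n)
    {R : ℝ} (hR : 0 < R) (h : ∀ m, 0 < m → m ≤ R → ∃ K : ℝ, ∀ (φ : RoumieuSpace M) (C : ℝ),
      StepBound M m (roumieuIncl M φ) C → ∀ n, w n * ‖hermiteCoeff (roumieuIncl M φ) n‖ ≤ K * C)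
    {B : Set (RoumieuSpace M)} (hB : Bornology.IsVonNBounded ℂ B) :
    ∃ K : ℝ, ∀ φ ∈ B, ∀ n, w n * ‖hermiteCoeff (roumieuIncl M φ) n‖ ≤ K := by
  have hbdd : ∀ φ : RoumieuSpace M,
      BddAbove (range fun n => w n * ‖hermiteCoeff (roumieuIncl M φ) n‖) := by
    intro φ
    obtain ⟨m, hm, hmR, C, hφ⟩ := roumieu_exists_stepBound φ hR
    obtain ⟨K, hK⟩ := h m hm hmR
    exact ⟨K * C, by rintro _ ⟨n, rfl⟩; exact hK φ C hφ n⟩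
  have hint : ∀ (φ : RoumieuSpace M) n,
      Integrable (fun x => roumieuIncl M φ x * hermiteC n x) := by
    intro φ n
    obtain ⟨m, hm, -, C, hφ⟩ := roumieu_exists_stepBound φ one_pos
    exact integrable_mul_hermiteC (hφ.integrable hm) n
  let q : Seminorm ℂ (RoumieuSpace M) := Seminorm.ofSMulLE
    (fun φ => ⨆ n, w n * ‖hermiteCoeff (roumieuIncl M φ) n‖)
    (by simp [hermiteCoeff])
    (fun φ ψ => ciSup_le fun n => by
      have e : hermiteCoeff (roumieuIncl M (φ + ψ)) n
          = hermiteCoeff (roumieuIncl M φ) n + hermiteCoeff (roumieuIncl M ψ) n := by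
        unfold hermiteCoeff
        rw [← integral_add (hint φ n) (hint ψ n)]
        simp [add_mul]
      refine le_trans ?_ (add_le_add (le_ciSup (hbdd φ) n) (le_ciSup (hbdd ψ) n))
      rw [e, ← mul_add]
      exact mul_le_mul_of_nonneg_left (norm_add_le _ _) (hw n))
    (fun c φ => ciSup_le fun n => by
      have e : hermiteCoeff (roumieuIncl M (c • φ)) n
          = c * hermiteCoeff (roumieuIncl M φ) n := by
        unfold hermiteCoeff
        rw [← integral_const_mul]
        simp [mul_assoc]
      rw [e, norm_mul, mul_left_comm]
      exact mul_le_mul_of_nonneg_left (le_ciSup (hbdd φ) n) (norm_nonneg c))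
  have hq : IsInductive M q := by
    intro m
    have hm0 : (0 : ℝ) < m := m.2
    obtain ⟨K, hK⟩ := h (min m R) (lt_min hm0 hR) (min_le_right _ _)
    exact ⟨K, fun φ hφ => ciSup_le fun n => hK φ _
      ((StepBound.of_mem hφ).mono (lt_min hm0 hR) (min_le_left _ _)) n⟩
  obtain ⟨K, -, hK⟩ := (roumieu_withSeminorms M).isVonNBounded_iff_seminorm_bounded.1 hB ⟨q, hq⟩
  exact ⟨K, fun φ hφ n => (le_ciSup (hbdd φ) n).trans (hK φ hφ).le⟩

/-! ### Beurling spaces -/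

/-- The inclusion of the Beurling space in the space of all functions. -/
def beurlingIncl (M : WeightSequence) : BeurlingSpace M →ₗ[ℂ] ℝ → ℂ where
  toFun := BeurlingSpace.toFun
  map_add' _ _ := rfl
  map_smul' _ _ := rfl

lemma beurling_stepBound {M : WeightSequence} (φ : BeurlingSpace M) (m : Ioi (0 : ℝ)) :
    StepBound M m (beurlingIncl M φ) (beurlingSeminorms M m φ) :=
  StepBound.of_mem (φ.mem_step m)

lemma beurling_exists_boundedOn {M : WeightSequence} (T : StrongDual ℂ (BeurlingSpace M)) :
    ∃ m : ℝ, 0 < m ∧ BoundedOn M (beurlingIncl M) m T.toLinearMap := by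
  obtain ⟨s, C, -, hC⟩ := Seminorm.bound_of_continuous (beurling_withSeminorms M)
    ((normSeminorm ℂ ℂ).comp T.toLinearMap) (continuous_norm.comp T.continuous)
  have hs : ∃ m : ℝ, 0 < m ∧ ∀ (φ : BeurlingSpace M) (B : ℝ),
      StepBound M m (beurlingIncl M φ) B → s.sup (beurlingSeminorms M) φ ≤ B := by
    clear hC
    induction s using Finset.cons_induction with
    | empty => exact ⟨1, one_pos, fun φ B h => by simpa using h.nonneg one_pos⟩
    | cons p s hp ih =>
      obtain ⟨m, hm, ih⟩ := ih
      have hp0 : (0 : ℝ) < p := p.2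
      refine ⟨max m p, lt_max_of_lt_left hm, fun φ B hφ => ?_⟩
      rw [Finset.sup_cons]
      refine sup_le ?_ ?_
      · exact StepBound.le (hφ.mono hp0 (le_max_right _ _))
      · exact ih φ B (hφ.mono hm (le_max_left _ _))
  obtain ⟨m, hm, hs⟩ := hs
  refine ⟨m, hm, C + 1, by positivity, fun φ B hφ => ?_⟩
  have hB := hφ.nonneg hm
  calc ‖T φ‖ ≤ C * s.sup (beurlingSeminorms M) φ := hC φ
    _ ≤ C * B := by gcongr; exact hs φ B hφ
    _ ≤ _ := by linarith

/-! ### Representation of the elements of the dual spaces -/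

/-- The Roumieu case: `μ` is arbitrary, as `T` is bounded on every `step M m`. -/
theorem roumieu_representation {M : WeightSequence} (hM : M.NontrivialRoumieu)
    (T : StrongDual ℂ (RoumieuSpace M)) {μ : ℝ} (hμ : 0 < μ) :
    ∃ f : ℝ →ᵇ ℂ, HasSum (fun β : ℕ => ((μ ^ (2 * β) / M (2 * β) * (1 / 2 ^ β) : ℝ) : ℂ) •
      (roumieuDualOsc M ^ β) (roumieuOfFun M f)) T := by
  obtain ⟨L, hL, hM⟩ := hM.exists_growthAt
  obtain ⟨A, H, hH⟩ := M.exists_stableWith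
  have hH0 := hH.2.1
  -- the parameters at which the Hermite functions are dominated by the symbol with parameter `ν`
  have hpar : ∀ ν : ℝ, 0 < ν → ∃ m : ℝ, 0 < m ∧ 9 * H * m * L ≤ 1 ∧ H * (9 * H * m) ≤ ν := by
    intro ν hν
    refine ⟨min (1 / (9 * H * L)) (ν / (9 * H ^ 2)), by positivity, ?_, ?_⟩
    · have := min_le_left (1 / (9 * H * L)) (ν / (9 * H ^ 2))
      rw [le_div_iff₀ (by positivity)] at this
      linarith
    · have := min_le_right (1 / (9 * H * L)) (ν / (9 * H ^ 2))
      rw [le_div_iff₀ (by positivity)] at this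
      linarith
  obtain ⟨m₀, hm₀, hm₀L, -⟩ := hpar 1 one_pos
  obtain ⟨K₀, hK₀⟩ := exists_stepBound_hermiteC hM hH hL hm₀ hm₀L le_rfl 0
  let e : ℕ → RoumieuSpace M := fun n =>
    ⟨hermiteC n, ⟨m₀, hm₀⟩, StepBound.mem (m := ⟨m₀, hm₀⟩) (hK₀.2 n)⟩
  have he : ∀ n, roumieuIncl M (e n) = hermiteC n := fun _ => rfl
  have hpair : ∀ m₁ : ℝ, 0 < m₁ → m₁ ≤ 1 / L →
      ∃ K : ℝ, 0 < K ∧ ∀ (φ : RoumieuSpace M) (C : ℝ), StepBound M m₁ (roumieuIncl M φ) C →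
      HasSum (fun n => hermiteCoeff (roumieuIncl M φ) n * T (e n)) (T φ) ∧
      ∀ n : ℕ, ‖T (e n)‖ * ‖hermiteCoeff (roumieuIncl M φ) n‖ * (n + 2) ^ 2 ≤ K * C := by
    intro m₁ hm₁ hm₁L
    have hν : 0 < m₁ / (5 * H) := by positivity
    obtain ⟨m, hm, hmL, hmν⟩ := hpar _ hν
    rw [le_div_iff₀ hL, mul_comm] at hm₁L
    exact (roumieu_boundedOn T hm).exists_hermite_pairing he hH hM hL hm hmL hν hmν hM hL hm₁
      hm₁L (by rw [mul_div_cancel₀ _ (by positivity)])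
  obtain ⟨m, hm, hmL, hmμ⟩ := hpar μ hμ
  obtain ⟨K, -, hK⟩ := (roumieu_boundedOn T hm).exists_norm_le_symbol he hM hH hL hm hmL hmμ
  have hL' : 0 < 1 / L := by positivity
  refine exists_hasSum_osc (J := roumieuIncl M) (e := e) (osc := roumieuOsc M) (fun φ => ?_)
    (fun _ => rfl) (fun _ _ => rfl) (fun _ _ => rfl) hM hK (fun φ => ?_) (fun B hB => ?_)
  · obtain ⟨m₁, hm₁, -, C, hφ⟩ := roumieu_exists_stepBound φ one_pos
    exact ⟨m₁, hm₁, C, hφ⟩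
  · obtain ⟨m₁, hm₁, hm₁L, C, hφ⟩ := roumieu_exists_stepBound φ hL'
    obtain ⟨K, -, h⟩ := hpair m₁ hm₁ hm₁L
    exact (h φ C hφ).1
  · obtain ⟨K, hK⟩ := roumieu_bounded_hermiteCoeff
      (w := fun n => ‖T (e n)‖ * ((n : ℝ) + 2) ^ 2) (fun n => by positivity) hL'
      (fun m₁ hm₁ hm₁L => by
        obtain ⟨K, -, h⟩ := hpair m₁ hm₁ hm₁L
        exact ⟨K, fun φ C hφ n => by simpa only [mul_right_comm] using (h φ C hφ).2 n⟩) hB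
    exact ⟨K, fun φ hφ n => by simpa only [mul_right_comm] using hK φ hφ n⟩

/-- The Beurling case: `μ` depends on the one `step M m` on which `T` is known to be bounded. The
growth of `M` is used at an `L` which depends on `m`. -/
theorem beurling_representation {M : WeightSequence} (hM : M.NontrivialBeurling)
    (T : StrongDual ℂ (BeurlingSpace M)) : ∃ μ : ℝ, 0 < μ ∧
    ∃ f : ℝ →ᵇ ℂ, HasSum (fun β : ℕ => ((μ ^ (2 * β) / M (2 * β) * (1 / 2 ^ β) : ℝ) : ℂ) •
      (beurlingDualOsc M ^ β) (beurlingOfFun M f)) T := by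
  obtain ⟨A, H, hH⟩ := M.exists_stableWith
  have hH0 := hH.2.1
  obtain ⟨m, hm, hT⟩ := beurling_exists_boundedOn T
  have he0 : ∀ n, hermiteC n ∈ beurling M := by
    intro n
    simp only [beurling, Submodule.mem_iInf]
    intro r
    have hr : (0 : ℝ) < r := r.2
    have hL : 0 < 1 / (9 * H * r) := by positivity
    obtain ⟨K, -, hK⟩ := exists_stepBound_hermiteC (hM.growthAt hL) hH hL hr
      (by rw [mul_one_div_cancel (by positivity)]) le_rfl 0
    exact StepBound.mem (hK n)
  let e : ℕ → BeurlingSpace M := fun n => ⟨hermiteC n, he0 n⟩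
  have he : ∀ n, beurlingIncl M (e n) = hermiteC n := fun _ => rfl
  have hL : 0 < 1 / (9 * H * m) := by positivity
  have hmL : 9 * H * m * (1 / (9 * H * m)) ≤ 1 := by rw [mul_one_div_cancel (by positivity)]
  set μ := H * (9 * H * m) with hμ
  have hμ0 : 0 < μ := by positivity
  set m₁ : Ioi (0 : ℝ) := ⟨5 * H * μ, mem_Ioi.2 (by positivity)⟩ with hm₁
  have hm₁0 : (0 : ℝ) < m₁ := m₁.2
  have hL₁ : 0 < 1 / (m₁ : ℝ) := by positivity
  obtain ⟨K₁, hK₁, hpair⟩ := hT.exists_hermite_pairing he hH (hM.growthAt hL) hL hm hmL hμ0 le_rfl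
    (hM.growthAt hL₁) hL₁ hm₁0 (by rw [one_div_mul_cancel hm₁0.ne']) le_rfl
  obtain ⟨K, -, hK⟩ := hT.exists_norm_le_symbol he (hM.growthAt hL) hH hL hm hmL hμ.ge
  refine ⟨μ, hμ0, exists_hasSum_osc (J := beurlingIncl M) (e := e) (osc := beurlingOsc M)
    (fun φ => ⟨m₁, hm₁0, _, beurling_stepBound φ m₁⟩) (fun _ => rfl) (fun _ _ => rfl)
    (fun _ _ => rfl) (hM.growthAt hL) hK
    (fun φ => (hpair φ _ (beurling_stepBound φ m₁)).1) (fun B hB => ?_)⟩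
  obtain ⟨r, -, hr⟩ := (beurling_withSeminorms M).isVonNBounded_iff_seminorm_bounded.1 hB m₁
  refine ⟨K₁ * r, fun φ hφ n => ((hpair φ _ (beurling_stepBound φ m₁)).2 n).trans ?_⟩
  gcongr
  exact (hr φ hφ).le

end GelfandShilov

theorem mainTheorem1 (M : GelfandShilov.WeightSequence) :
    (M.NontrivialRoumieu →
      ∀ T : StrongDual ℂ (GelfandShilov.RoumieuSpace M), ∀ μ : ℝ, 0 < μ →
        ∃ f : ℝ →ᵇ ℂ,
          HasSum (fun β : ℕ => ((μ ^ (2 * β) / M (2 * β) * (1 / 2 ^ β) : ℝ) : ℂ) •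
            (GelfandShilov.roumieuDualOsc M ^ β) (GelfandShilov.roumieuOfFun M f)) T) ∧
    (M.NontrivialBeurling →
      ∀ T : StrongDual ℂ (GelfandShilov.BeurlingSpace M), ∃ μ : ℝ, 0 < μ ∧
        ∃ f : ℝ →ᵇ ℂ,
          HasSum (fun β : ℕ => ((μ ^ (2 * β) / M (2 * β) * (1 / 2 ^ β) : ℝ) : ℂ) •
            (GelfandShilov.beurlingDualOsc M ^ β) (GelfandShilov.beurlingOfFun M f)) T) :=
  ⟨fun hM T _ hμ => GelfandShilov.roumieu_representation hM T hμ,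
    fun hM T => GelfandShilov.beurling_representation hM T⟩
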